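/- Let $\mathbb T=\mathbb R/\mathbb Z$ and let $f:\mathbb T\to(0,\infty)$ be a real analytic function that is not a trigonometric polynomial, with $\int_{\mathbb T} f=1$ and Fourier coefficients $a_k=\int_{\mathbb T} f(x)e^{-2\pi i kx}\,dx$. For $n\ge 1$ put $T_n=\sum_{j\ge 2}|a_{jn}|\,|jn|$, and let $1\le l_1<l_2<\cdots$ be integers with $a_{l_k}\neq 0$ for all $k$ and $|a_{l_k}|/T_{l_k}\to\infty$ (that is, $T_{l_k}/|a_{l_k}|\to0$). For an irrational number $\alpha$ let $q_0(\alpha)=1,\ q_1(\alpha),\ q_2(\alpha),\dots$ be the denominators of the convergents of its continued fraction. Let $\beta$ be irrational and write $q_n'=q_n(\beta)$. For $k\ge 1$ let $\eta(k)$ be the smallest $n\ge1$ with $q_n'>2k^2/|a_{l_k}|^2$. For $n,j\ge 1$ define $$V_{n,j}=\{\alpha\in\mathbb R\setminus\mathbb Q:\ q_n(\alpha)=l_j,\ q_{n+1}(\alpha)>2q'_{\eta(j)}n^2\},\qquad \mathcal U_j=\bigcup_{n\ge1}V_{n,j},\qquad \mathcal U=\bigcap_{M\ge1}\bigcup_{j\ge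 M}\mathcal U_j .$$ Let $T^f_\alpha=(T_t)_{t\in\mathbb R}$ be the special flow over the rotation $x\mapsto x+\alpha$ of $\mathbb T$ under the roof $f$: it acts on $\{(x,r):0\le r<f(x)\}$, with Lebesgue measure, by $T_t(x,r)=(x+n\alpha,\ r+t-S_n(f)(x))$, where $S_n(f)$, $n\in\mathbb Z$, are the Birkhoff sums of $f$ over the rotation (the additive cocycle with $S_0(f)=0$ and $S_{n+1}(f)(x)=S_n(f)(x)+f(x+n\alpha)$) and $n$ is the unique integer with $S_n(f)(x)\le r+t<S_{n+1}(f)(x)$. A measure-preserving flow $(T_t)$ on a probability space $(X,\mu)$ is mixing along a real sequence $t_n\to\infty$ if $\langle g_1\circ T_{t_n},g_2\rangle\to\langle g_1,1\rangle\langle 1,g_2\rangle$ for all $g_1,g_2\in L^2(X,\mu)$. **Theorem.** For every $\alpha\in\mathcal U$ the flow $T_\alpha^f$ is mixing along a subsequence of $(q'_{\eta(j)})_{j\ge1}$, namely along the indices $j$ with $\alpha\in\mathcal U_j$: there are strictly increasing sequences $1\le k_1<k_2<\cdots$ with $\alpha\in\mathcal U_{k_n}$ for all $n$, and for every such sequence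 $T_\alpha^f$ is mixing along $(q'_{\eta(k_n)})_{n\ge1}$. -/

import Mathlib

open MeasureTheory Filter Topology

noncomputable section

namespace SpecialFlowMixing

/-! ### Special flows over circle rotations -/

/-- The Birkhoff cocycle `S_n(f)(x)`, `n ∈ ℤ`, over the rotation `x ↦ x + α` of `ℝ/ℤ`:
`∑_{0 ≤ i < n} f (x + i α)` for `n ≥ 0` and `-∑_{n ≤ i < 0} f (x + i α)` for `n < 0`
(one of the two sums below is always empty). -/
def birkhoff (α : ℝ) (f : UnitAddCircle → ℝ) (n : ℤ) (x : UnitAddCircle) : ℝ :=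
  ∑ i ∈ Finset.Ico (0 : ℤ) n, f (x + i • (α : UnitAddCircle))
    - ∑ i ∈ Finset.Ico n (0 : ℤ), f (x + i • (α : UnitAddCircle))

/-- The region `{(x, r) : 0 ≤ r < f x}` below the roof function. -/
def flowSpace (f : UnitAddCircle → ℝ) : Set (UnitAddCircle × ℝ) :=
  {p | 0 ≤ p.2 ∧ p.2 < f p.1}

/-- Lebesgue measure on the region below the roof (of total mass `∫ f`). -/
def flowMeasure (f : UnitAddCircle → ℝ) : Measure (UnitAddCircle × ℝ) :=
  (volume : Measure (UnitAddCircle × ℝ)).restrict (flowSpace f)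

/-- The integer `n` with `S_n(f)(x) ≤ s < S_{n+1}(f)(x)`; it exists and is unique
for continuous `f > 0`, see `existsUnique_crossings`. -/
def crossings (α : ℝ) (f : UnitAddCircle → ℝ) (x : UnitAddCircle) (s : ℝ) : ℤ :=
  Classical.epsilon fun n : ℤ => birkhoff α f n x ≤ s ∧ s < birkhoff α f (n + 1) x

/-- The time-`t` map of the special flow over the rotation by `α` under the roof `f`:
`T_t (x, r) = (x + n α, r + t - S_n(f)(x))` with `S_n(f)(x) ≤ r + t < S_{n+1}(f)(x)`.
Only its values on `flowSpace f` matter, as `flowMeasure f` is carried by that set. -/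
def specialFlow (α : ℝ) (f : UnitAddCircle → ℝ) (t : ℝ) (p : UnitAddCircle × ℝ) :
    UnitAddCircle × ℝ :=
  (p.1 + crossings α f p.1 (p.2 + t) • (α : UnitAddCircle),
    p.2 + t - birkhoff α f (crossings α f p.1 (p.2 + t)) p.1)

theorem birkhoff_zero (α : ℝ) (f : UnitAddCircle → ℝ) (x : UnitAddCircle) :
    birkhoff α f 0 x = 0 := by
  simp [birkhoff]

theorem birkhoff_add_one (α : ℝ) (f : UnitAddCircle → ℝ) (n : ℤ) (x : UnitAddCircle) :
    birkhoff α f (n + 1) x = birkhoff α f n x + f (x + n • (α : UnitAddCircle)) := by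
  unfold birkhoff
  rcases le_or_gt 0 n with h | h
  · have h1 : Finset.Ico (0 : ℤ) (n + 1) = insert n (Finset.Ico 0 n) := by
      ext i; simp; omega
    have h2 : Finset.Ico n (0 : ℤ) = ∅ := by ext i; simp; omega
    have h3 : Finset.Ico (n + 1) (0 : ℤ) = ∅ := by ext i; simp; omega
    rw [h1, h2, h3, Finset.sum_insert (by simp)]
    simp; ring
  · have h1 : Finset.Ico n (0 : ℤ) = insert n (Finset.Ico (n + 1) 0) := by
      ext i; simp; omega
    have h2 : Finset.Ico (0 : ℤ) n = ∅ := by ext i; simp; omega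
    have h3 : Finset.Ico (0 : ℤ) (n + 1) = ∅ := by ext i; simp; omega
    rw [h1, h2, h3, Finset.sum_insert (by simp)]
    simp

theorem existsUnique_crossings (α : ℝ) {f : UnitAddCircle → ℝ} (hf : Continuous f)
    (hpos : ∀ x, 0 < f x) (x : UnitAddCircle) (s : ℝ) :
    ∃! n : ℤ, birkhoff α f n x ≤ s ∧ s < birkhoff α f (n + 1) x := by
  obtain ⟨y, -, hy⟩ := isCompact_univ.exists_isMinOn
    (Set.univ_nonempty (α := UnitAddCircle)) hf.continuousOn
  have hc : ∀ z, f y ≤ f z := fun z => hy (Set.mem_univ z)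
  have hmono : StrictMono fun n : ℤ => birkhoff α f n x :=
    strictMono_int_of_lt_succ fun n => by
      rw [birkhoff_add_one]; linarith [hpos (x + n • (α : UnitAddCircle))]
  have hup : ∀ n : ℕ, (n : ℝ) * f y ≤ birkhoff α f n x := by
    intro n
    induction n with
    | zero => simp [birkhoff_zero]
    | succ k ih =>
      push_cast
      rw [birkhoff_add_one]
      linarith [hc (x + (k : ℤ) • (α : UnitAddCircle))]
  have hdown : ∀ n : ℕ, birkhoff α f (-(n : ℤ)) x ≤ -((n : ℝ) * f y) := by
    intro n
    induction n with
    | zero => simp [birkhoff_zero]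
    | succ k ih =>
      have h := birkhoff_add_one α f (-((k + 1 : ℕ) : ℤ)) x
      have e : -((k + 1 : ℕ) : ℤ) + 1 = -(k : ℤ) := by push_cast; ring
      rw [e] at h
      push_cast at h ⊢
      linarith [hc (x + (-((k : ℤ) + 1)) • (α : UnitAddCircle))]
  obtain ⟨N, hN⟩ := exists_nat_gt (|s| / f y)
  rw [div_lt_iff₀ (hpos y)] at hN
  obtain ⟨n, hn, hmax⟩ := Int.exists_greatest_of_bdd
    (P := fun n : ℤ => birkhoff α f n x ≤ s)
    ⟨N, fun z hz => by
      by_contra hlt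
      have := hmono (not_le.mp hlt)
      simp only at this
      linarith [hup N, le_abs_self s]⟩
    ⟨-(N : ℤ), by linarith [hdown N, neg_abs_le s]⟩
  refine ⟨n, ⟨hn, ?_⟩, ?_⟩
  · by_contra h
    have := hmax (n + 1) (not_lt.mp h)
    omega
  · rintro m ⟨hm1, hm2⟩
    have h1 : m < n + 1 := by
      by_contra h
      have h' := hmax m hm1
      omega
    have h2 : n < m + 1 := hmono.lt_iff_lt.mp (lt_of_le_of_lt hn hm2)
    omega

/-! ### Mixing along a sequence -/

/-- A measure-preserving flow `T` on a probability space is mixing along a real sequence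
`a_n → ∞` if `⟨g₁ ∘ T_{a_n}, g₂⟩ → ⟨g₁, 1⟩ ⟨1, g₂⟩` for all `g₁, g₂ ∈ L²`. -/
structure IsMixingAlong {X : Type*} [MeasurableSpace X] (T : ℝ → X → X) (μ : Measure X)
    (a : ℕ → ℝ) : Prop where
  isProbabilityMeasure : IsProbabilityMeasure μ
  measurePreserving : ∀ t, MeasurePreserving (T t) μ μ
  tendsto_atTop : Tendsto a atTop atTop
  tendsto_correlation : ∀ g₁ g₂ : X → ℂ, MemLp g₁ 2 μ → MemLp g₂ 2 μ →
    Tendsto (fun n => ∫ x, g₁ (T (a n) x) * (starRingEnd ℂ) (g₂ x) ∂μ) atTop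
      (𝓝 ((∫ x, g₁ x ∂μ) * ∫ x, (starRingEnd ℂ) (g₂ x) ∂μ))

/-! ### The roof function and its Fourier coefficients -/

/-- Real analyticity of a function on the circle `ℝ/ℤ`. -/
def IsRealAnalytic (f : UnitAddCircle → ℝ) : Prop :=
  AnalyticOnNhd ℝ (fun x : ℝ => f (x : UnitAddCircle)) Set.univ

/-- `f` is a (finite) trigonometric polynomial. -/
def IsTrigPolynomial (f : UnitAddCircle → ℝ) : Prop :=
  ∃ c : ℤ →₀ ℂ, ∀ x : UnitAddCircle, (f x : ℂ) = c.sum fun k z => z * fourier k x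

/-- The Fourier coefficient `a_k = ∫ f(x) e^{-2πikx} dx`. -/
def coeff (f : UnitAddCircle → ℝ) (k : ℤ) : ℂ :=
  fourierCoeff (fun x : UnitAddCircle => (f x : ℂ)) k

/-- `T_n = ∑_{j ≥ 2} |a_{jn}| |jn|`. -/
def fourierTail (f : UnitAddCircle → ℝ) (n : ℕ) : ℝ :=
  ∑' j : ℕ, ‖coeff f (((j + 2) * n : ℕ) : ℤ)‖ * (((j + 2) * n : ℕ) : ℝ)

/-- `l_1 < l_2 < ⋯` are positive integers with `a_{l_k} ≠ 0` and `|a_{l_k} / T_{l_k}| → ∞`.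
The limit is written for the reciprocals, so that `T_{l_k} = 0` (quotient `∞`) is allowed.
The value `l 0` plays no role. -/
structure IsDominantSequence (f : UnitAddCircle → ℝ) (l : ℕ → ℕ) : Prop where
  strictMonoOn : StrictMonoOn l (Set.Ici 1)
  pos : ∀ k, 1 ≤ k → 0 < l k
  coeff_ne_zero : ∀ k, 1 ≤ k → coeff f (l k) ≠ 0
  tendsto_zero : Tendsto (fun k => fourierTail f (l k) / ‖coeff f (l k)‖) atTop (𝓝 0)

/-! ### The set of rotation numbers -/

/-- The denominator `q_n(α)` of the `n`-th convergent of the continued fraction of `α`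
(`q_0 = 1`, `q_1 = a_1`, `q_n = a_n q_{n-1} + q_{n-2}`). -/
def convDen (α : ℝ) (n : ℕ) : ℝ :=
  (GenContFract.of α).dens n

/-- `η(k)`: the smallest index `n ≥ 1` with `q_n(β) > 2 k² / |a_{l_k}|²`. -/
def eta (β : ℝ) (f : UnitAddCircle → ℝ) (l : ℕ → ℕ) (k : ℕ) : ℕ :=
  sInf {n : ℕ | 1 ≤ n ∧ 2 * (k : ℝ) ^ 2 / ‖coeff f (l k)‖ ^ 2 < convDen β n}

/-- `V_{n,m}`: irrational `α` with `q_n(α) = l_m` and `q_{n+1}(α) > 2 q_{η(m)}(β) n²`. -/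
def setV (β : ℝ) (f : UnitAddCircle → ℝ) (l : ℕ → ℕ) (n m : ℕ) : Set ℝ :=
  {α | Irrational α ∧ convDen α n = l m ∧
    2 * convDen β (eta β f l m) * (n : ℝ) ^ 2 < convDen α (n + 1)}

/-- `U_j = ⋃_{n ≥ 1} V_{n,j}`. -/
def setUj (β : ℝ) (f : UnitAddCircle → ℝ) (l : ℕ → ℕ) (j : ℕ) : Set ℝ :=
  ⋃ n ≥ 1, setV β f l n j

/-- `U = ⋂_{M ≥ 1} ⋃_{j ≥ M} U_j`. -/
def setU (β : ℝ) (f : UnitAddCircle → ℝ) (l : ℕ → ℕ) : Set ℝ :=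
  ⋂ M ≥ 1, ⋃ j ≥ M, setUj β f l j

end SpecialFlowMixing

end

open MeasureTheory Filter Topology

noncomputable section

namespace SpecialFlowMixing

/-! ### Continued fractions and small divisors -/

/-! Mixing comes from shear. Along the given indices let `q` be the selected frequency, `a = |a_q|`,
`t` the selected denominator of `β`, and `Q` the denominator of `α` that follows `q`. The
definitions of `η` and `V` give `t a → ∞` and `t / Q → 0`, and `T_q / a → 0` by assumption; this is
`exists_isResonant`.

On the time scale `t` the frequency `q` is almost resonant: `qα` is within `1/Q` of an integer, so
the harmonics `±q` of a Birkhoff sum grow linearly in the number of steps. The other multiples of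
`q` are controlled by `T_q`; the non-multiples up to `Q/4` have geometric sums at most `q`; the
higher ones are damped by the decay of the coefficients. Hence for `n = O(t)` and `|h| = O(1/(t a
q))` the increment `S_n(x+h) - S_n(x)` is `-4π q h n Im(a_q e(qx))` up to `o(1)`
(`abs_birkhoff_increment_le`, `IsResonant.eventually_increment`).

Slide a point horizontally over a distance `S/(t a q)`. This distance tends to `0`, yet after time
`t` the image has swept out nearly an orbit segment of the flow, of length comparable to `S |Im(a_q
e(qx))| / a`. Since `α` is irrational, time averages of the flow converge uniformly
(`IsTest.norm_integral_lift_sub_le`). For a large constant `S` the average of `φ ∘ T_t` over the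
slide is therefore close to `∫ φ`, except for `x` in a set whose measure is small uniformly in `q`
(`IsResonant.eventually_average`).

Slides preserve Lebesgue measure and barely move `ψ`, so a correlation equals its average over
slides and tends to the product of the integrals (`IsResonant.tendsto_correlation`). Density of test
functions gives all of `L²`. As slides do not preserve the region below the roof, functions are
lifted to `𝕋 × ℝ`, on which the flow is vertical translation and from which the region arises as the
quotient by `(x, v) ~ (x + α, v - f x)`. -/

theorem not_terminatedAt_of_irrational {α : ℝ} (hα : Irrational α) (n : ℕ) :
    ¬ (GenContFract.of α).TerminatedAt n := fun h => by
  obtain ⟨q, hq⟩ := GenContFract.exists_rat_eq_of_terminates ⟨n, h⟩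
  exact hα ⟨q, hq.symm⟩

theorem convDen_monotone (α : ℝ) : Monotone (convDen α) :=
  monotone_nat_of_le_succ fun _ => GenContFract.of_den_mono

theorem tendsto_convDen {α : ℝ} (hα : Irrational α) : Tendsto (convDen α) atTop atTop := by
  refine tendsto_atTop_mono' atTop ?_ (tendsto_natCast_atTop_atTop (R := ℝ))
  filter_upwards [eventually_ge_atTop 5] with n hn
  have h := GenContFract.succ_nth_fib_le_of_nth_den (v := α) (n := n)
    (Or.inr (not_terminatedAt_of_irrational hα (n - 1)))
  have h1 : n ≤ Nat.fib (n + 1) := (Nat.le_fib_self hn).trans Nat.fib_le_fib_succ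
  exact (Nat.cast_le.mpr h1).trans h

/-- The convergents live in `ℝ`; their integrality is what allows divisibility arguments later. A
terminated expansion only repeats the last pair. -/
theorem exists_int_eq_contsAux (α : ℝ) (n : ℕ) :
    (∃ a : ℤ, ((GenContFract.of α).contsAux n).a = a) ∧
      ∃ b : ℤ, ((GenContFract.of α).contsAux n).b = b := by
  induction n using Nat.strong_induction_on with
  | _ n ih =>
    match n with
    | 0 => exact ⟨⟨1, by simp⟩, ⟨0, by simp⟩⟩
    | 1 => exact ⟨⟨⌊α⌋, by simp⟩, ⟨1, by simp⟩⟩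
    | m + 2 =>
      obtain ⟨⟨a, ha⟩, ⟨b, hb⟩⟩ := ih m (by omega)
      obtain ⟨⟨a', ha'⟩, ⟨b', hb'⟩⟩ := ih (m + 1) (by omega)
      rcases hs : (GenContFract.of α).s.get? m with _ | gp
      · simp only [GenContFract.contsAux, hs]
        exact ⟨⟨a', ha'⟩, ⟨b', hb'⟩⟩
      · obtain ⟨h1, z, h2⟩ := GenContFract.of_partNum_eq_one_and_exists_int_partDen_eq hs
        rw [GenContFract.contsAux_recurrence hs rfl rfl, h1, h2, ha, hb, ha', hb']
        exact ⟨⟨z * a' + 1 * a, by push_cast; ring⟩, ⟨z * b' + 1 * b, by push_cast; ring⟩⟩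

theorem exists_int_eq_nums (α : ℝ) (n : ℕ) : ∃ a : ℤ, (GenContFract.of α).nums n = a :=
  (exists_int_eq_contsAux α (n + 1)).1

theorem exists_int_eq_dens (α : ℝ) (n : ℕ) : ∃ a : ℤ, (GenContFract.of α).dens n = a :=
  (exists_int_eq_contsAux α (n + 1)).2

theorem exists_isCoprime_abs_sub_le {α : ℝ} (hα : Irrational α) {n q : ℕ}
    (hq : convDen α n = q) :
    ∃ p : ℤ, IsCoprime p q ∧ |α - p / q| ≤ 1 / (q * convDen α (n + 1)) := by
  obtain ⟨p, hp⟩ := exists_int_eq_nums α n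
  obtain ⟨p', hp'⟩ := exists_int_eq_nums α (n + 1)
  obtain ⟨q', hq'⟩ := exists_int_eq_dens α (n + 1)
  refine ⟨p, ?_, ?_⟩
  · have hd := SimpContFract.determinant (s := SimpContFract.of α)
      (not_terminatedAt_of_irrational hα n)
    change (GenContFract.of α).nums n * (GenContFract.of α).dens (n + 1) -
      (GenContFract.of α).dens n * (GenContFract.of α).nums (n + 1) = (-1) ^ (n + 1) at hd
    unfold convDen at hq
    rw [hp, hp', hq, hq'] at hd
    have hd' : p * q' - q * p' = (-1 : ℤ) ^ (n + 1) := by exact_mod_cast hd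
    refine ⟨(-1) ^ (n + 1) * q', -((-1) ^ (n + 1) * p'), ?_⟩
    have : ((-1 : ℤ) ^ (n + 1)) * (-1) ^ (n + 1) = 1 := by
      rw [← mul_pow]; simp
    linear_combination this + (-1 : ℤ) ^ (n + 1) * hd'
  · have h := GenContFract.abs_sub_convs_le (not_terminatedAt_of_irrational hα n)
    rw [GenContFract.conv_eq_num_div_den] at h
    unfold convDen at hq ⊢
    rwa [hp, hq] at h

theorem fourier_coe_eq_exp (k : ℤ) (x : ℝ) :
    (fourier k (x : UnitAddCircle) : ℂ) = Complex.exp (Complex.I * (2 * Real.pi * (k * x) : ℝ)) := by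
  rw [fourier_coe_apply]; congr 1; push_cast; ring

theorem norm_fourier_sub_one_le (k : ℤ) (x : ℝ) :
    ‖(fourier k (x : UnitAddCircle) : ℂ) - 1‖ ≤ 2 * Real.pi * (|(k : ℝ)| * |x|) := by
  rw [fourier_coe_eq_exp]
  refine (Real.norm_exp_I_mul_ofReal_sub_one_le).trans (le_of_eq ?_)
  rw [Real.norm_eq_abs, abs_mul, abs_of_pos Real.two_pi_pos, abs_mul]

/-- `|e(y) - 1| = 2 |sin πy|`, and Jordan's inequality `|sin u| ≥ 2|u|/π` applies for `|u| ≤ π/2`.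
-/
theorem le_norm_fourier_sub_one (k : ℤ) (x : ℝ) (m : ℤ) (h : |k * x - m| ≤ 1 / 2) :
    4 * |k * x - m| ≤ ‖(fourier k (x : UnitAddCircle) : ℂ) - 1‖ := by
  have e : (fourier k (x : UnitAddCircle) : ℂ)
      = Complex.exp (Complex.I * (2 * Real.pi * (k * x - m) : ℝ)) := by
    rw [fourier_coe_eq_exp, Complex.exp_eq_exp_iff_exists_int]
    exact ⟨m, by push_cast; ring⟩
  rw [e, Complex.norm_exp_I_mul_ofReal_sub_one, norm_mul, Real.norm_eq_abs, Real.norm_eq_abs,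
    abs_two]
  have e2 : 2 * Real.pi * (k * x - m) / 2 = Real.pi * (k * x - m) := by ring
  have := Real.mul_abs_le_abs_sin (x := Real.pi * (k * x - m)) (by
    rw [abs_mul, abs_of_pos Real.pi_pos]; nlinarith [Real.pi_pos])
  rw [abs_mul, abs_of_pos Real.pi_pos] at this
  rw [e2]
  have h3 : 2 / Real.pi * (Real.pi * |k * x - m|) = 2 * |k * x - m| := by
    field_simp
  linarith

/-- As `p/q` is reduced and `q ∤ k`, the number `kp/q` is at distance at least `1/q` from every
integer. Replacing `p/q` by `α` costs at most `1/(4q)` because `|k| ≤ Q/4`. The remaining `3/(4q)`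
is multiplied by the factor `4` of `le_norm_fourier_sub_one`. -/
theorem three_div_le_norm_fourier_sub_one {α Q : ℝ} {q : ℕ} (hq : 0 < q) (hQ : 0 < Q) {p : ℤ}
    (hp : IsCoprime p q) (hpq : |α - p / q| ≤ 1 / (q * Q)) {k : ℤ} (hk : ¬ (q : ℤ) ∣ k)
    (hkQ : |(k : ℝ)| ≤ Q / 4) :
    3 / q ≤ ‖(fourier k (α : UnitAddCircle) : ℂ) - 1‖ := by
  have hq' : (0 : ℝ) < q := by exact_mod_cast hq
  have h1 : |k * α - k * p / q| ≤ 1 / (4 * q) := by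
    have : k * α - k * p / q = k * (α - p / q) := by ring
    rw [this, abs_mul]
    calc |(k : ℝ)| * |α - p / q| ≤ Q / 4 * (1 / (q * Q)) := by gcongr
      _ = 1 / (4 * q) := by field_simp
  have h2 : 1 / (q : ℝ) ≤ |(k * p / q - round (k * α) : ℝ)| := by
    have e : (k * p / q - round (k * α) : ℝ) = ((k * p - q * round (k * α) : ℤ) : ℝ) / q := by
      push_cast; field_simp
    rw [e, abs_div, abs_of_pos hq', ← Int.cast_abs]
    gcongr
    rw [← Int.cast_one (R := ℝ)]
    refine Int.cast_le.mpr (Int.one_le_abs fun h0 => hk ?_)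
    have : (q : ℤ) ∣ k * p := ⟨round (k * α), by linarith⟩
    exact hp.symm.dvd_of_dvd_mul_right this
  have h3 := le_norm_fourier_sub_one k α (round (k * α)) (abs_sub_round _)
  have h4 : 1 / (q : ℝ) - 1 / (4 * q) ≤ |k * α - round (k * α)| := by
    have := abs_sub_abs_le_abs_sub (k * p / q - round (k * α) : ℝ) (k * p / q - k * α)
    rw [abs_sub_comm (k * p / q : ℝ) (k * α)] at this
    have e : (k * p / q - round (k * α) - (k * p / q - k * α) : ℝ) = k * α - round (k * α) := by
      ring
    rw [e] at this
    linarith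
  have h5 : 1 / (q : ℝ) - 1 / (4 * q) = 3 / q / 4 := by field_simp; norm_num
  linarith

theorem norm_fourier_sub_one_le_of_approx {α Q : ℝ} {q : ℕ} (hq : 0 < q) (hQ : 0 < Q) {p : ℤ}
    (hpq : |α - p / q| ≤ 1 / (q * Q)) :
    ‖(fourier (q : ℤ) (α : UnitAddCircle) : ℂ) - 1‖ ≤ 2 * Real.pi / Q := by
  have hq' : (0 : ℝ) < q := by exact_mod_cast hq
  have e : (fourier (q : ℤ) (α : UnitAddCircle) : ℂ)
      = Complex.exp (Complex.I * (2 * Real.pi * (q * α - p) : ℝ)) := by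
    rw [fourier_coe_eq_exp, Complex.exp_eq_exp_iff_exists_int]
    exact ⟨p, by push_cast; ring⟩
  rw [e]
  refine (Real.norm_exp_I_mul_ofReal_sub_one_le).trans ?_
  rw [Real.norm_eq_abs, abs_mul, abs_of_pos Real.two_pi_pos, div_eq_mul_one_div]
  gcongr
  have : q * α - p = q * (α - p / q) := by field_simp
  rw [this, abs_mul, abs_of_pos hq']
  calc (q : ℝ) * |α - p / q| ≤ q * (1 / (q * Q)) := by gcongr
    _ = 1 / Q := by field_simp

/-! ### Fourier series of smooth functions -/

theorem IsRealAnalytic.continuous {f : UnitAddCircle → ℝ} (hf : IsRealAnalytic f) :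
    Continuous f := by
  refine QuotientAddGroup.isOpenQuotientMap_mk.isQuotientMap.continuous_iff.mpr ?_
  exact continuousOn_univ.mp hf.continuousOn

/-- Integration by parts, with boundary terms cancelling by periodicity; the gain `1/(2π|k|)` is
weakened to `1/|k|`. -/
theorem norm_fourierCoeffOn_le_div {F : ℝ → ℂ} (hF : ContDiff ℝ 1 F)
    (hper : Function.Periodic F 1) {k : ℤ} (hk : k ≠ 0) :
    ‖fourierCoeffOn zero_lt_one F k‖ ≤ ‖fourierCoeffOn zero_lt_one (deriv F) k‖ / |(k : ℝ)| := by
  have hd : ∀ x, HasDerivAt F (deriv F x) x := fun x =>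
    (hF.differentiable (by norm_num)).differentiableAt.hasDerivAt
  rw [fourierCoeffOn_of_hasDerivAt zero_lt_one hk (fun x _ => hd x)
    ((hF.continuous_deriv (by norm_num)).intervalIntegrable _ _)]
  have h0 : F 1 - F 0 = 0 := by
    have := hper 0
    rw [zero_add] at this
    rw [this, sub_self]
  rw [h0, mul_zero, zero_sub]
  simp only [Complex.ofReal_one, Complex.ofReal_zero, sub_zero, one_mul, norm_mul, norm_neg,
    norm_div, norm_one, Complex.norm_I, mul_one, Complex.norm_real, Complex.norm_intCast,
    Real.norm_eq_abs, abs_of_pos Real.pi_pos, Complex.norm_ofNat]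
  have hk' : 0 < |(k : ℝ)| := abs_pos.mpr (by exact_mod_cast hk)
  rw [one_div, inv_mul_eq_div]
  gcongr
  nlinarith [Real.pi_gt_three]

theorem norm_fourierCoeffOn_le_iteratedDeriv {F : ℝ → ℂ} (hF : ContDiff ℝ ⊤ F)
    (hper : Function.Periodic F 1) {k : ℤ} (hk : k ≠ 0) (m : ℕ) :
    ‖fourierCoeffOn zero_lt_one F k‖
      ≤ ‖fourierCoeffOn zero_lt_one (iteratedDeriv m F) k‖ / |(k : ℝ)| ^ m := by
  have hper' : ∀ m, Function.Periodic (iteratedDeriv m F) 1 := by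
    intro m x
    have := iteratedDeriv_comp_add_const m F 1
    have h2 : (fun z => F (z + 1)) = F := funext hper
    rw [h2] at this
    exact (congrFun this x).symm
  induction m with
  | zero => simp
  | succ m ih =>
    refine ih.trans ?_
    rw [pow_succ', iteratedDeriv_succ, ← div_div]
    gcongr
    refine norm_fourierCoeffOn_le_div ?_ (hper' m) hk
    rw [iteratedDeriv_eq_iterate]
    exact ContDiff.iterate_deriv' 1 m (hF.of_le le_top)

theorem exists_norm_coeff_le {f : UnitAddCircle → ℝ} (hf : IsRealAnalytic f) (m : ℕ) :
    ∃ C : ℝ, 0 ≤ C ∧ ∀ k : ℤ, k ≠ 0 → ‖coeff f k‖ ≤ C / |(k : ℝ)| ^ m := by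
  set F : ℝ → ℂ := fun x => (f (x : UnitAddCircle) : ℂ) with hFdef
  have hF : ContDiff ℝ ⊤ F :=
    Complex.ofRealCLM.contDiff.comp (contDiffOn_univ.mp hf.contDiffOn_of_completeSpace)
  have hper : Function.Periodic F 1 := fun x => by simp [hFdef]
  have hcont : Continuous (iteratedDeriv m F) := hF.continuous_iteratedDeriv m le_top
  obtain ⟨C, hC⟩ := isCompact_Icc.exists_bound_of_continuousOn (s := Set.Icc (0 : ℝ) 1)
    hcont.continuousOn
  refine ⟨C, (norm_nonneg _).trans (hC 0 (by simp)), fun k hk => ?_⟩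
  have h1 : coeff f k = fourierCoeffOn zero_lt_one F k := by
    rw [coeff, fourierCoeff_eq_intervalIntegral _ _ 0, fourierCoeffOn_eq_integral]
    simp [hFdef]
  rw [h1]
  refine (norm_fourierCoeffOn_le_iteratedDeriv hF hper hk m).trans ?_
  gcongr
  rw [fourierCoeffOn_eq_integral]
  simp only [sub_zero, div_one, one_smul]
  refine (intervalIntegral.norm_integral_le_of_norm_le_const (C := C) fun x hx => ?_).trans
    (by simp)
  rw [Set.uIoc_of_le zero_le_one] at hx
  rw [norm_smul]
  have : ‖(fourier (-k) (x : AddCircle (1 - 0 : ℝ)) : ℂ)‖ = 1 := by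
    rw [fourier_apply]; exact Circle.norm_coe _
  rw [this, one_mul]
  exact hC x ⟨hx.1.le, hx.2⟩

/-- The second moment is needed for frequencies above `Q/4`, where one factor `|k|` pays for the
missing small-divisor bound. -/
theorem summable_norm_coeff_mul_sq {f : UnitAddCircle → ℝ} (hf : IsRealAnalytic f) :
    Summable fun k : ℤ => ‖coeff f k‖ * |(k : ℝ)| ^ 2 := by
  obtain ⟨C, hC0, hC⟩ := exists_norm_coeff_le hf 4
  refine Summable.of_nonneg_of_le (fun k => by positivity) (fun k => ?_)
    ((Real.summable_one_div_int_pow (p := 2)).mpr one_lt_two |>.mul_left C)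
  rcases eq_or_ne k 0 with rfl | hk
  · simp
  · have hk' : 0 < |(k : ℝ)| := abs_pos.mpr (by exact_mod_cast hk)
    calc ‖coeff f k‖ * |(k : ℝ)| ^ 2 ≤ C / |(k : ℝ)| ^ 4 * |(k : ℝ)| ^ 2 := by gcongr; exact hC k hk
      _ = C * (1 / |(k : ℝ)| ^ 2) := by field_simp
      _ = C * (1 / (k : ℝ) ^ 2) := by rw [sq_abs]

theorem one_le_abs_intCast {k : ℤ} (hk : k ≠ 0) : 1 ≤ |(k : ℝ)| := by
  rw [← Int.cast_abs, ← Int.cast_one (R := ℝ)]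
  exact Int.cast_le.mpr (Int.one_le_abs hk)

theorem summable_norm_coeff_mul_abs {f : UnitAddCircle → ℝ} (hf : IsRealAnalytic f) :
    Summable fun k : ℤ => ‖coeff f k‖ * |(k : ℝ)| := by
  refine Summable.of_nonneg_of_le (fun k => by positivity) (fun k => ?_)
    (summable_norm_coeff_mul_sq hf)
  rcases eq_or_ne k 0 with rfl | hk
  · simp
  · gcongr
    exact le_self_pow₀ (one_le_abs_intCast hk) two_ne_zero

theorem summable_coeff {f : UnitAddCircle → ℝ} (hf : IsRealAnalytic f) :
    Summable (coeff f) := by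
  refine Summable.of_norm ?_
  refine Summable.of_norm_bounded_eventually (summable_norm_coeff_mul_abs hf) ?_
  refine (Set.finite_singleton (0 : ℤ)).subset fun k hk => ?_
  by_contra h
  refine hk ?_
  change ‖‖coeff f k‖‖ ≤ _
  rw [norm_norm]
  exact le_mul_of_one_le_right (norm_nonneg _) (one_le_abs_intCast h)

theorem hasSum_coeff_mul_fourier {f : UnitAddCircle → ℝ} (hf : IsRealAnalytic f)
    (x : UnitAddCircle) : HasSum (fun k : ℤ => coeff f k * fourier k x) (f x : ℂ) := by
  have hc : Continuous fun x => (f x : ℂ) := Complex.continuous_ofReal.comp hf.continuous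
  exact has_pointwise_sum_fourier_series_of_summable
    (f := (⟨fun x => (f x : ℂ), hc⟩ : C(UnitAddCircle, ℂ))) (summable_coeff hf) x

theorem coeff_neg (f : UnitAddCircle → ℝ) (k : ℤ) :
    coeff f (-k) = (starRingEnd ℂ) (coeff f k) := by
  unfold coeff fourierCoeff
  rw [← integral_conj]
  congr 1
  ext x
  simp [smul_eq_mul]

theorem norm_coeff_neg (f : UnitAddCircle → ℝ) (k : ℤ) : ‖coeff f (-k)‖ = ‖coeff f k‖ := by
  rw [coeff_neg, RCLike.norm_conj]

/-- For a roof of integral `1` this gives `|a_k| ≤ 1`, so a lower bound on `t |a_q|²` also bounds `t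
|a_q|` and `t` from below. -/
theorem norm_coeff_le_integral {f : UnitAddCircle → ℝ} (hpos : ∀ x, 0 < f x) (k : ℤ) :
    ‖coeff f k‖ ≤ ∫ x, f x := by
  unfold coeff fourierCoeff
  refine (norm_integral_le_integral_norm _).trans (le_of_eq ?_)
  have hv : (AddCircle.haarAddCircle : Measure UnitAddCircle) = volume := by
    rw [AddCircle.volume_eq_smul_haarAddCircle]; simp
  rw [hv]
  congr 1
  ext x
  rw [norm_smul, fourier_apply, Circle.norm_coe, one_mul, Complex.norm_real, Real.norm_eq_abs,
    abs_of_pos (hpos x)]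

/-! ### Increments of Birkhoff sums -/

theorem fourier_add_arg (k : ℤ) (x y : UnitAddCircle) :
    (fourier k (x + y) : ℂ) = fourier k x * fourier k y := by
  simp [fourier_apply, smul_add, AddCircle.toCircle_add]

theorem norm_fourier_apply (k : ℤ) (x : UnitAddCircle) : ‖(fourier k x : ℂ)‖ = 1 := by
  rw [fourier_apply]; exact Circle.norm_coe _

theorem fourier_nsmul_arg (k : ℤ) (n : ℕ) (x : UnitAddCircle) :
    (fourier k (n • x) : ℂ) = fourier k x ^ n := by
  induction n with
  | zero => simp [fourier_apply]
  | succ n ih => rw [succ_nsmul, fourier_add_arg, ih, pow_succ]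

theorem birkhoff_natCast (α : ℝ) (f : UnitAddCircle → ℝ) (n : ℕ) (x : UnitAddCircle) :
    birkhoff α f n x = ∑ i ∈ Finset.range n, f (x + i • (α : UnitAddCircle)) := by
  induction n with
  | zero => simp [birkhoff_zero]
  | succ n ih =>
    push_cast
    rw [birkhoff_add_one, ih, Finset.sum_range_succ, natCast_zsmul]

theorem hasSum_birkhoff {f : UnitAddCircle → ℝ} (hf : IsRealAnalytic f) (α : ℝ) (n : ℕ)
    (x : UnitAddCircle) :
    HasSum (fun k : ℤ => coeff f k * (∑ i ∈ Finset.range n, (fourier k (α : UnitAddCircle) : ℂ) ^ i)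
      * fourier k x) (birkhoff α f n x : ℂ) := by
  rw [birkhoff_natCast]
  push_cast
  convert hasSum_sum (f := fun (i : ℕ) (k : ℤ) => coeff f k *
    (fourier k (x + i • (α : UnitAddCircle)) : ℂ)) (s := Finset.range n)
    (fun i _ => hasSum_coeff_mul_fourier hf (x + i • (α : UnitAddCircle))) using 2 with k
  rw [Finset.mul_sum, Finset.sum_mul]
  refine Finset.sum_congr rfl fun i _ => ?_
  rw [fourier_add_arg, fourier_nsmul_arg]
  ring

/-- Three regimes for geometric sums: this trivial bound serves the multiples of `q` and the very
high frequencies, the next one the non-multiples, and the third the resonant frequency `q` itself.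
-/
theorem norm_geom_sum_le {z : ℂ} (hz : ‖z‖ = 1) (n : ℕ) :
    ‖∑ i ∈ Finset.range n, z ^ i‖ ≤ n := by
  refine (norm_sum_le _ _).trans ?_
  simp [hz]

theorem norm_geom_sum_mul_le {z : ℂ} (hz : ‖z‖ = 1) (n : ℕ) :
    ‖∑ i ∈ Finset.range n, z ^ i‖ * ‖z - 1‖ ≤ 2 := by
  rw [← norm_mul, geom_sum_mul]
  refine (norm_sub_le _ _).trans ?_
  simp [hz]; norm_num

theorem norm_geom_sum_sub_le {z : ℂ} (hz : ‖z‖ = 1) (n : ℕ) :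
    ‖∑ i ∈ Finset.range n, z ^ i - n‖ ≤ n ^ 2 * ‖z - 1‖ := by
  have h1 : ∑ i ∈ Finset.range n, z ^ i - n = ∑ i ∈ Finset.range n, (z ^ i - 1) := by
    simp [Finset.sum_sub_distrib]
  rw [h1]
  refine (norm_sum_le _ _).trans ?_
  have h2 : ∀ i ∈ Finset.range n, ‖z ^ i - 1‖ ≤ n * ‖z - 1‖ := by
    intro i hi
    rw [← geom_sum_mul, norm_mul]
    gcongr
    refine (norm_geom_sum_le hz i).trans ?_
    exact_mod_cast (Finset.mem_range.mp hi).le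
  refine (Finset.sum_le_sum h2).trans (le_of_eq ?_)
  simp; ring

/-- The terms `|a_k| |k|` with `k ≠ ± q` a multiple of `q` add up to `2 T_q`. -/
theorem hasSum_multiples {f : UnitAddCircle → ℝ} (hf : IsRealAnalytic f) {q : ℕ} (hq : 0 < q) :
    HasSum (fun k : ℤ => if (q : ℤ) ∣ k ∧ k ≠ q ∧ k ≠ -q then ‖coeff f k‖ * |(k : ℝ)| else 0)
      (2 * fourierTail f q) := by
  have hq' : (q : ℤ) ≠ 0 := by exact_mod_cast hq.ne'
  set m : ℤ → ℝ := fun k => if (q : ℤ) ∣ k ∧ k ≠ q ∧ k ≠ -q then ‖coeff f k‖ * |(k : ℝ)| else 0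
    with hm
  have hinj : Function.Injective fun j : ℤ => j * (q : ℤ) := mul_left_injective₀ hq'
  rw [← hinj.hasSum_iff]
  swap
  · intro k hk
    refine if_neg fun h => hk ?_
    obtain ⟨j, hj⟩ := h.1
    exact ⟨j, by rw [hj]; ring⟩
  have hval : ∀ j : ℤ, j ≠ 1 → j ≠ -1 → m (j * q) = ‖coeff f (j * q)‖ * |((j * q : ℤ) : ℝ)| := by
    intro j h1 h2
    refine if_pos ⟨Dvd.intro_left j rfl, fun h => h1 ?_, fun h => h2 ?_⟩
    · exact hinj (by simpa using h)
    · exact hinj (by simpa using h)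
  have htail : HasSum (fun j : ℕ => ‖coeff f (((j + 2) * q : ℕ) : ℤ)‖ * (((j + 2) * q : ℕ) : ℝ))
      (fourierTail f q) := by
    refine Summable.hasSum ?_
    have hi : Function.Injective fun j : ℕ => (((j + 2) * q : ℕ) : ℤ) := by
      intro a b hab
      have : (a + 2) * q = (b + 2) * q := Int.natCast_inj.mp hab
      have := Nat.eq_of_mul_eq_mul_right hq this
      omega
    refine ((summable_norm_coeff_mul_abs hf).comp_injective hi).congr fun j => ?_
    simp only [Function.comp_apply, Int.cast_natCast, Nat.abs_cast]
  rw [two_mul]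
  -- Both halves `j ≥ 0` and `j < 0` sum to `T_q`: the first after dropping `j = 0, 1`, the second
  -- after dropping `j = -1` and using `|a_{-k}| = |a_k|`.
  refine HasSum.of_nat_of_neg_add_one ?_ ?_
  · rw [← hasSum_nat_add_iff' 2]
    have h0 : m (0 * q) = 0 := by simp [hm]
    have h1 : m (1 * q) = 0 := by simp [hm]
    have hs : ∑ i ∈ Finset.range 2, (m ∘ fun j => j * (q : ℤ)) (i : ℤ) = 0 := by
      simp only [Finset.sum_range_succ, Finset.sum_range_zero, Function.comp_apply, Nat.cast_zero,
        Nat.cast_one]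
      rw [h0, h1]; ring
    rw [hs, sub_zero]
    refine (congrArg (HasSum · _) (funext fun j => ?_)).mpr htail
    simp only [Function.comp_apply]
    rw [hval _ (by omega) (by omega), abs_of_nonneg (by positivity)]
    push_cast
    rfl
  · rw [← hasSum_nat_add_iff' 1]
    have h1 : m (-1 * q) = 0 := by simp [hm]
    have hs : ∑ i ∈ Finset.range 1, (m ∘ fun j => j * (q : ℤ)) (-((i : ℤ) + 1)) = 0 := by
      simp only [Finset.sum_range_succ, Finset.sum_range_zero, Function.comp_apply, Nat.cast_zero,
        zero_add]
      exact h1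
    rw [hs, sub_zero]
    refine (congrArg (HasSum · _) (funext fun j => ?_)).mpr htail
    simp only [Function.comp_apply]
    rw [hval _ (by omega) (by omega)]
    have e : (-(((j + 1 : ℕ) : ℤ) + 1)) * (q : ℤ) = -(((j + 2) * q : ℕ) : ℤ) := by
      push_cast; ring
    rw [e, norm_coeff_neg]
    push_cast
    rw [abs_neg, abs_of_nonneg (by positivity)]

/-- The contribution of a single frequency to the increment of a Birkhoff sum. -/
def incrementTerm (α : ℝ) (f : UnitAddCircle → ℝ) (n : ℕ) (h : ℝ) (x : UnitAddCircle) (k : ℤ) : ℂ :=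
  coeff f k * (∑ i ∈ Finset.range n, (fourier k (α : UnitAddCircle) : ℂ) ^ i)
    * (fourier k (h : UnitAddCircle) - 1) * fourier k x

theorem hasSum_incrementTerm {f : UnitAddCircle → ℝ} (hf : IsRealAnalytic f) (α : ℝ) (n : ℕ) (h : ℝ)
    (x : UnitAddCircle) :
    HasSum (incrementTerm α f n h x)
      ((birkhoff α f n (x + h) - birkhoff α f n x : ℝ) : ℂ) := by
  push_cast
  refine (congrArg (HasSum · _) (funext fun k => ?_)).mpr
    ((hasSum_birkhoff hf α n (x + h)).sub (hasSum_birkhoff hf α n x))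
  rw [incrementTerm, fourier_add_arg]; ring

theorem incrementTerm_neg (α : ℝ) (f : UnitAddCircle → ℝ) (n : ℕ) (h : ℝ) (x : UnitAddCircle)
    (k : ℤ) :
    incrementTerm α f n h x (-k) = (starRingEnd ℂ) (incrementTerm α f n h x k) := by
  simp [incrementTerm, coeff_neg]

theorem norm_incrementTerm_le (α : ℝ) (f : UnitAddCircle → ℝ) (n : ℕ) (h : ℝ) (x : UnitAddCircle)
    (k : ℤ) {D : ℝ}
    (hD : ‖∑ i ∈ Finset.range n, (fourier k (α : UnitAddCircle) : ℂ) ^ i‖ ≤ D) :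
    ‖incrementTerm α f n h x k‖ ≤ 2 * Real.pi * |h| * (D * (‖coeff f k‖ * |(k : ℝ)|)) := by
  rw [incrementTerm, norm_mul, norm_fourier_apply, mul_one, norm_mul, norm_mul]
  have h0 : 0 ≤ D := (norm_nonneg _).trans hD
  calc _ ≤ ‖coeff f k‖ * D * (2 * Real.pi * (|(k : ℝ)| * |h|)) := by
        gcongr
        exact norm_fourier_sub_one_le k h
    _ = _ := by ring

/-- Two linearisations at once: the geometric sum `D` is replaced by `n`, and `e(qh) - 1` by `2πi q
h`. The error splits as `(D - n) E + n (E - ω)`. -/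
theorem norm_incrementTerm_sub_le {α Q : ℝ} (f : UnitAddCircle → ℝ) {q : ℕ}
    (hz : ‖(fourier (q : ℤ) (α : UnitAddCircle) : ℂ) - 1‖ ≤ 2 * Real.pi / Q) (n : ℕ) {h : ℝ}
    (hqh : 2 * Real.pi * (q * |h|) ≤ 1) (x : UnitAddCircle) :
    ‖incrementTerm α f n h x q
        - coeff f q * fourier (q : ℤ) x * (n * (2 * Real.pi * q * h) * Complex.I)‖
      ≤ ‖coeff f q‖ * (n ^ 2 * (2 * Real.pi / Q) * (2 * Real.pi * (q * |h|))
        + n * (2 * Real.pi * (q * |h|)) ^ 2) := by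
  set D : ℂ := ∑ i ∈ Finset.range n, (fourier (q : ℤ) (α : UnitAddCircle) : ℂ) ^ i with hD
  set E : ℂ := fourier (q : ℤ) (h : UnitAddCircle) - 1 with hE
  set ω : ℂ := Complex.I * (2 * Real.pi * (q * h) : ℝ) with hω
  have hnω : ‖ω‖ = 2 * Real.pi * (q * |h|) := by
    rw [hω, norm_mul, Complex.norm_I, one_mul, Complex.norm_real, Real.norm_eq_abs, abs_mul,
      abs_of_pos Real.two_pi_pos, abs_mul, Nat.abs_cast]
  have e : incrementTerm α f n h x q
        - coeff f q * fourier (q : ℤ) x * (n * (2 * Real.pi * q * h) * Complex.I)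
      = coeff f q * fourier (q : ℤ) x * ((D - n) * E + n * (E - ω)) := by
    rw [incrementTerm, hω]; push_cast; ring
  have hE1 : ‖E‖ ≤ 2 * Real.pi * (q * |h|) := by
    have := norm_fourier_sub_one_le q h
    rwa [Int.cast_natCast, Nat.abs_cast] at this
  have hE2 : ‖E - ω‖ ≤ (2 * Real.pi * (q * |h|)) ^ 2 := by
    have h1 : E = Complex.exp ω - 1 := by
      rw [hE, fourier_coe_eq_exp, hω]; simp
    rw [h1, ← hnω]
    exact Complex.norm_exp_sub_one_sub_id_le (by rw [hnω]; exact hqh)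
  rw [e, norm_mul, norm_mul, norm_fourier_apply, mul_one]
  gcongr
  refine (norm_add_le _ _).trans ?_
  rw [norm_mul, norm_mul, Complex.norm_natCast]
  have hD1 : ‖D - n‖ ≤ n ^ 2 * (2 * Real.pi / Q) :=
    (norm_geom_sum_sub_le (norm_fourier_apply _ _) n).trans (by gcongr)
  have : 0 ≤ (n : ℝ) ^ 2 * (2 * Real.pi / Q) := (norm_nonneg _).trans hD1
  gcongr

/-- The increment of the `n`-th Birkhoff sum is governed by the frequency `q`. -/
theorem abs_birkhoff_increment_le {f : UnitAddCircle → ℝ} (hf : IsRealAnalytic f) {α Q : ℝ} {q : ℕ}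
    (hq : 0 < q) (hQ : 0 < Q) {p : ℤ} (hp : IsCoprime p q) (hpq : |α - p / q| ≤ 1 / (q * Q))
    (n : ℕ) {h : ℝ} (hqh : 2 * Real.pi * (q * |h|) ≤ 1) (x : UnitAddCircle) :
    |birkhoff α f n (x + h) - birkhoff α f n x
        + 4 * Real.pi * q * h * n * (coeff f q * fourier (q : ℤ) x).im|
      ≤ 2 * Real.pi * |h| * (n * (2 * fourierTail f q)
          + q * ∑' k : ℤ, ‖coeff f k‖ * |(k : ℝ)|
          + n * (4 / Q) * ∑' k : ℤ, ‖coeff f k‖ * |(k : ℝ)| ^ 2)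
        + 2 * (‖coeff f q‖ * (n ^ 2 * (2 * Real.pi / Q) * (2 * Real.pi * (q * |h|))
        + n * (2 * Real.pi * (q * |h|)) ^ 2)) := by
  set b := incrementTerm α f n h x with hb
  set Δ : ℝ := birkhoff α f n (x + h) - birkhoff α f n x with hΔ
  have hq0 : (0 : ℝ) < q := by exact_mod_cast hq
  -- The resonant frequencies `±q` are removed; the rest is dominated termwise by `hmaj`, whose
  -- three summands serve the other multiples of `q`, the non-multiples with `|k| ≤ Q/4`, and the
  -- non-multiples beyond.
  have hsum : HasSum (fun k => b k - (if k = (q : ℤ) then b q else 0)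
      - (if k = -(q : ℤ) then b (-q) else 0)) ((Δ : ℂ) - b q - b (-q)) :=
    ((hasSum_incrementTerm hf α n h x).sub (hasSum_ite_eq _ _)).sub (hasSum_ite_eq _ _)
  have hmaj : HasSum (fun k : ℤ => 2 * Real.pi * |h| *
      (n * (if (q : ℤ) ∣ k ∧ k ≠ q ∧ k ≠ -q then ‖coeff f k‖ * |(k : ℝ)| else 0)
        + q * (‖coeff f k‖ * |(k : ℝ)|) + n * (4 / Q) * (‖coeff f k‖ * |(k : ℝ)| ^ 2)))
      (2 * Real.pi * |h| * (n * (2 * fourierTail f q)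
          + q * ∑' k : ℤ, ‖coeff f k‖ * |(k : ℝ)|
          + n * (4 / Q) * ∑' k : ℤ, ‖coeff f k‖ * |(k : ℝ)| ^ 2)) :=
    ((((hasSum_multiples hf hq).mul_left _).add
      ((summable_norm_coeff_mul_abs hf).hasSum.mul_left _)).add
      ((summable_norm_coeff_mul_sq hf).hasSum.mul_left _)).mul_left _
  have hbound : ‖(Δ : ℂ) - b q - b (-q)‖ ≤ 2 * Real.pi * |h| * (n * (2 * fourierTail f q)
      + q * ∑' k : ℤ, ‖coeff f k‖ * |(k : ℝ)|
      + n * (4 / Q) * ∑' k : ℤ, ‖coeff f k‖ * |(k : ℝ)| ^ 2) := by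
    rw [← hsum.tsum_eq]
    refine tsum_of_norm_bounded hmaj fun k => ?_
    have hpos : 0 ≤ q * (‖coeff f k‖ * |(k : ℝ)|) := by positivity
    have hpos' : 0 ≤ n * (4 / Q) * (‖coeff f k‖ * |(k : ℝ)| ^ 2) := by positivity
    have hqq : (q : ℤ) ≠ -q := by omega
    by_cases h1 : k = q
    · subst h1
      simp only [if_true, if_neg hqq, sub_self, norm_zero]
      simp only [ne_eq, not_true_eq_false, false_and, and_false, if_false, mul_zero, zero_add]
      positivity
    by_cases h2 : k = -q
    · subst h2
      simp only [if_true, if_neg hqq.symm, sub_self, sub_zero, norm_zero]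
      simp only [ne_eq, not_true_eq_false, and_false, if_false, mul_zero, zero_add]
      positivity
    rw [if_neg h1, if_neg h2, sub_zero, sub_zero]
    by_cases h3 : (q : ℤ) ∣ k
    · rw [if_pos ⟨h3, h1, h2⟩]
      refine (norm_incrementTerm_le α f n h x k
        (norm_geom_sum_le (norm_fourier_apply _ _) n)).trans ?_
      gcongr
      linarith
    · rw [if_neg fun h => h3 h.1, mul_zero, zero_add]
      by_cases h4 : |(k : ℝ)| ≤ Q / 4
      · have hz := three_div_le_norm_fourier_sub_one hq hQ hp hpq h3 h4
        have hg := norm_geom_sum_mul_le (norm_fourier_apply k (α : UnitAddCircle)) n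
        have hD : ‖∑ i ∈ Finset.range n, (fourier k (α : UnitAddCircle) : ℂ) ^ i‖ ≤ q := by
          have h5 : ‖∑ i ∈ Finset.range n, (fourier k (α : UnitAddCircle) : ℂ) ^ i‖ * (3 / q) ≤ 2 :=
            (mul_le_mul_of_nonneg_left hz (norm_nonneg _)).trans hg
          rw [mul_div_assoc', div_le_iff₀ hq0] at h5
          linarith
        refine (norm_incrementTerm_le α f n h x k hD).trans ?_
        gcongr
        linarith
      · refine (norm_incrementTerm_le α f n h x k
          (norm_geom_sum_le (norm_fourier_apply _ _) n)).trans ?_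
        gcongr
        refine le_trans ?_ (le_add_of_nonneg_left hpos)
        have h5 : 1 ≤ 4 / Q * |(k : ℝ)| := by
          rw [div_mul_eq_mul_div, le_div_iff₀ hQ]; linarith [not_le.mp h4]
        calc (n : ℝ) * (‖coeff f k‖ * |(k : ℝ)|)
            ≤ n * (‖coeff f k‖ * |(k : ℝ)|) * (4 / Q * |(k : ℝ)|) :=
              le_mul_of_one_le_right (by positivity) h5
          _ = _ := by ring
  have hmain := norm_incrementTerm_sub_le f (norm_fourier_sub_one_le_of_approx hq hQ hpq) n hqh x
  rw [← hb] at hmain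
  set w : ℂ := coeff f q * fourier (q : ℤ) x * (n * (2 * Real.pi * q * h) * Complex.I) with hw
  -- The terms at `q` and `-q` are conjugate, so together they contribute twice a real part.
  have hre : (b q).re * 2 = (b q + b (-q)).re := by
    rw [hb, incrementTerm_neg, Complex.add_re, Complex.conj_re]; ring
  have hwre : 2 * w.re = -(4 * Real.pi * q * h * n * (coeff f q * fourier (q : ℤ) x).im) := by
    have : w = ((n * (2 * Real.pi * q * h) : ℝ) : ℂ) * (coeff f q * fourier (q : ℤ) x * Complex.I) := by
      rw [hw]; push_cast; ring
    rw [this, Complex.re_ofReal_mul, Complex.mul_I_re]; ring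
  have key : Δ + 4 * Real.pi * q * h * n * (coeff f q * fourier (q : ℤ) x).im
      = ((Δ : ℂ) - b q - b (-q)).re + 2 * (b q - w).re := by
    simp only [Complex.sub_re, Complex.ofReal_re]
    rw [Complex.add_re] at hre
    linarith
  rw [key]
  refine (abs_add_le _ _).trans (add_le_add ((Complex.abs_re_le_norm _).trans hbound) ?_)
  rw [abs_mul, abs_two]
  gcongr
  exact (Complex.abs_re_le_norm _).trans hmain

/-! ### The special flow preserves the measure -/

theorem birkhoff_add (α : ℝ) (f : UnitAddCircle → ℝ) (n m : ℤ) (x : UnitAddCircle) :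
    birkhoff α f (n + m) x = birkhoff α f n x + birkhoff α f m (x + n • (α : UnitAddCircle)) := by
  induction m using Int.induction_on with
  | zero => simp [birkhoff_zero]
  | succ m ih =>
    rw [← add_assoc, birkhoff_add_one, ih, birkhoff_add_one, add_zsmul, ← add_assoc x, add_assoc]
  | pred m ih =>
    have h1 := birkhoff_add_one α f (n + (-(m : ℤ) - 1)) x
    have h2 := birkhoff_add_one α f (-(m : ℤ) - 1) (x + n • (α : UnitAddCircle))
    have e1 : n + (-(m : ℤ) - 1) + 1 = n + -(m : ℤ) := by ring
    have e2 : -(m : ℤ) - 1 + 1 = -(m : ℤ) := by ring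
    rw [e1, ih, add_zsmul, ← add_assoc x] at h1
    rw [e2] at h2
    linarith

theorem continuous_birkhoff (α : ℝ) {f : UnitAddCircle → ℝ} (hf : Continuous f) (n : ℤ) :
    Continuous (birkhoff α f n) := by
  unfold birkhoff
  fun_prop

theorem birkhoff_strictMono (α : ℝ) {f : UnitAddCircle → ℝ} (hpos : ∀ x, 0 < f x)
    (x : UnitAddCircle) : StrictMono fun n : ℤ => birkhoff α f n x :=
  strictMono_int_of_lt_succ fun n => by
    rw [birkhoff_add_one]; linarith [hpos (x + n • (α : UnitAddCircle))]

theorem crossings_spec (α : ℝ) {f : UnitAddCircle → ℝ} (hf : Continuous f)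
    (hpos : ∀ x, 0 < f x) (x : UnitAddCircle) (s : ℝ) :
    birkhoff α f (crossings α f x s) x ≤ s ∧ s < birkhoff α f (crossings α f x s + 1) x :=
  Classical.epsilon_spec (existsUnique_crossings α hf hpos x s).exists

theorem crossings_eq_iff (α : ℝ) {f : UnitAddCircle → ℝ} (hf : Continuous f)
    (hpos : ∀ x, 0 < f x) {x : UnitAddCircle} {s : ℝ} {n : ℤ} :
    crossings α f x s = n ↔ birkhoff α f n x ≤ s ∧ s < birkhoff α f (n + 1) x :=
  ⟨fun h => h ▸ crossings_spec α hf hpos x s, fun h =>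
    (existsUnique_crossings α hf hpos x s).unique (crossings_spec α hf hpos x s) h⟩

/-- The map `(x, r) ↦ (x + n α, r + t - S_n(f)(x))`, with which the time-`t` map of the special
flow agrees where the orbit crosses the roof `n` times. -/
def skewMap (α : ℝ) (f : UnitAddCircle → ℝ) (n : ℤ) (t : ℝ) (p : UnitAddCircle × ℝ) :
    UnitAddCircle × ℝ :=
  (p.1 + n • (α : UnitAddCircle), p.2 + t - birkhoff α f n p.1)

theorem continuous_skewMap (α : ℝ) {f : UnitAddCircle → ℝ} (hf : Continuous f) (n : ℤ) (t : ℝ) :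
    Continuous (skewMap α f n t) := by
  have := continuous_birkhoff α hf n
  unfold skewMap
  fun_prop

theorem measurePreserving_skewMap (α : ℝ) {f : UnitAddCircle → ℝ} (hf : Continuous f) (n : ℤ)
    (t : ℝ) : MeasurePreserving (skewMap α f n t) volume volume := by
  have hc := continuous_birkhoff α hf n
  refine (measurePreserving_add_right (volume : Measure UnitAddCircle)
    (n • (α : UnitAddCircle))).skew_product (μc := (volume : Measure ℝ))
    (g := fun x r => r + t - birkhoff α f n x) (Continuous.measurable (by fun_prop)) ?_
  refine Eventually.of_forall fun x => ?_
  have : (fun r : ℝ => r + t - birkhoff α f n x) = fun r => r + (t - birkhoff α f n x) := by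
    ext r; ring
  rw [this]
  exact map_add_right_eq_self volume _

theorem skewMap_skewMap (α : ℝ) (f : UnitAddCircle → ℝ) (n : ℤ) (t : ℝ)
    (p : UnitAddCircle × ℝ) : skewMap α f (-n) (-t) (skewMap α f n t p) = p := by
  have h := birkhoff_add α f n (-n) p.1
  rw [add_neg_cancel, birkhoff_zero] at h
  refine Prod.ext ?_ ?_
  · simp [skewMap]
  · simp only [skewMap]; linarith

/-- Identifies the piece with `n` crossings as the preimage of the flow space under the `n`-th skew
map. Hence the pieces are disjoint and measurable, with no separate study of `crossings`. -/
theorem skewMap_mem_flowSpace (α : ℝ) {f : UnitAddCircle → ℝ} (hf : Continuous f)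
    (hpos : ∀ x, 0 < f x) (n : ℤ) (t : ℝ) (p : UnitAddCircle × ℝ) :
    skewMap α f n t p ∈ flowSpace f ↔ crossings α f p.1 (p.2 + t) = n := by
  rw [crossings_eq_iff α hf hpos, birkhoff_add_one]
  simp only [skewMap, flowSpace, Set.mem_ofPred_eq]
  constructor <;> rintro ⟨h1, h2⟩ <;> constructor <;> linarith

theorem specialFlow_eq_skewMap (α : ℝ) (f : UnitAddCircle → ℝ) (t : ℝ) (p : UnitAddCircle × ℝ) :
    specialFlow α f t p = skewMap α f (crossings α f p.1 (p.2 + t)) t p := rfl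

theorem measurableSet_flowSpace {f : UnitAddCircle → ℝ} (hf : Continuous f) :
    MeasurableSet (flowSpace f) :=
  (measurableSet_le measurable_const measurable_snd).inter
    (measurableSet_lt measurable_snd (hf.measurable.comp measurable_fst))

theorem measurable_specialFlow (α : ℝ) {f : UnitAddCircle → ℝ} (hf : Continuous f)
    (hpos : ∀ x, 0 < f x) (t : ℝ) : Measurable (specialFlow α f t) := by
  intro A hA
  have : specialFlow α f t ⁻¹' A = ⋃ n : ℤ, skewMap α f n t ⁻¹' (A ∩ flowSpace f) := by
    ext p
    simp only [Set.mem_preimage, Set.mem_iUnion, Set.mem_inter_iff,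
      skewMap_mem_flowSpace α hf hpos, specialFlow_eq_skewMap]
    constructor
    · exact fun h => ⟨_, h, rfl⟩
    · rintro ⟨n, h, rfl⟩; exact h
  rw [this]
  exact MeasurableSet.iUnion fun n => (continuous_skewMap α hf n t).measurable
    (hA.inter (measurableSet_flowSpace hf))

theorem measurePreserving_specialFlow (α : ℝ) {f : UnitAddCircle → ℝ} (hf : Continuous f)
    (hpos : ∀ x, 0 < f x) (t : ℝ) :
    MeasurePreserving (specialFlow α f t) (flowMeasure f) (flowMeasure f) := by
  refine ⟨measurable_specialFlow α hf hpos t, Measure.ext fun A hA => ?_⟩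
  have hF := measurableSet_flowSpace hf
  rw [Measure.map_apply (measurable_specialFlow α hf hpos t) hA, flowMeasure,
    Measure.restrict_apply (measurable_specialFlow α hf hpos t hA), Measure.restrict_apply hA]
  have hdisj : ∀ (s : ℝ) (B : Set (UnitAddCircle × ℝ)), Pairwise (Function.onFun Disjoint
      fun n : ℤ => B ∩ {p | skewMap α f n s p ∈ flowSpace f}) := by
    intro s B n m hnm
    refine Set.disjoint_left.mpr fun p hp hp' => hnm ?_
    rw [← (skewMap_mem_flowSpace α hf hpos n s p).mp hp.2]
    exact (skewMap_mem_flowSpace α hf hpos m s p).mp hp'.2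
  have hmeas : ∀ (s : ℝ) (n : ℤ), MeasurableSet {p | skewMap α f n s p ∈ flowSpace f} :=
    fun s n => (continuous_skewMap α hf n s).measurable hF
  have h1 : specialFlow α f t ⁻¹' A ∩ flowSpace f = ⋃ n : ℤ,
      (specialFlow α f t ⁻¹' A ∩ flowSpace f) ∩ {p | skewMap α f n t p ∈ flowSpace f} := by
    rw [← Set.inter_iUnion]
    exact (Set.inter_eq_left.mpr fun p _ => Set.mem_iUnion.mpr
      ⟨_, (skewMap_mem_flowSpace α hf hpos _ t p).mpr rfl⟩).symm
  -- The target is cut according to the crossings of the backward flow, so that the `n`-th skew map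
  -- matches the `n`-th piece of the source with the `n`-th piece of the target.
  have h2 : A ∩ flowSpace f = ⋃ n : ℤ,
      (A ∩ flowSpace f) ∩ {p | skewMap α f (-n) (-t) p ∈ flowSpace f} := by
    rw [← Set.inter_iUnion]
    exact (Set.inter_eq_left.mpr fun p _ => Set.mem_iUnion.mpr ⟨-(crossings α f p.1 (p.2 + -t)),
      (skewMap_mem_flowSpace α hf hpos _ (-t) p).mpr (neg_neg _).symm⟩).symm
  have hdisj' : Pairwise (Function.onFun Disjoint fun n : ℤ =>
      (A ∩ flowSpace f) ∩ {p | skewMap α f (-n) (-t) p ∈ flowSpace f}) :=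
    fun n m hnm => hdisj (-t) _ (neg_injective.ne hnm)
  rw [h1, h2, measure_iUnion (hdisj t _) fun n =>
      ((measurable_specialFlow α hf hpos t hA).inter hF).inter (hmeas t n),
    measure_iUnion hdisj' fun n =>
      (hA.inter hF).inter (hmeas (-t) (-n))]
  refine tsum_congr fun n => ?_
  rw [← (measurePreserving_skewMap α hf n t).measure_preimage
    ((hA.inter hF).inter (hmeas (-t) (-n))).nullMeasurableSet]
  congr 1
  ext p
  simp only [Set.mem_inter_iff, Set.mem_preimage, Set.mem_ofPred_eq, skewMap_skewMap]
  constructor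
  · rintro ⟨⟨h3, h4⟩, h5⟩
    have h6 := (skewMap_mem_flowSpace α hf hpos n t p).mp h5
    rw [specialFlow_eq_skewMap, h6] at h3
    exact ⟨⟨h3, h5⟩, h4⟩
  · rintro ⟨⟨h3, h5⟩, h4⟩
    have h6 := (skewMap_mem_flowSpace α hf hpos n t p).mp h5
    rw [specialFlow_eq_skewMap, h6]
    exact ⟨⟨h3, h4⟩, h5⟩

/-! ### Test functions and their lifts to `𝕋 × ℝ` -/

/-- Continuous functions on `𝕋 × ℝ` that vanish off `{(x, r) : 0 < r < f x}`. -/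
structure IsTest (f : UnitAddCircle → ℝ) (φ : UnitAddCircle × ℝ → ℂ) : Prop where
  continuous : Continuous φ
  support : ∀ p, φ p ≠ 0 → 0 < p.2 ∧ p.2 < f p.1

/-- The function on `𝕋 × ℝ` that takes at `(x, v)` the value of `φ` at the point which the orbit
of `(x, 0)` reaches at time `v`. -/
def lift (α : ℝ) (f : UnitAddCircle → ℝ) (φ : UnitAddCircle × ℝ → ℂ) (x : UnitAddCircle) (v : ℝ) :
    ℂ :=
  φ (x + crossings α f x v • (α : UnitAddCircle), v - birkhoff α f (crossings α f x v) x)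

theorem comp_specialFlow (α : ℝ) (f : UnitAddCircle → ℝ) (φ : UnitAddCircle × ℝ → ℂ) (t : ℝ)
    (p : UnitAddCircle × ℝ) : φ (specialFlow α f t p) = lift α f φ p.1 (p.2 + t) := rfl

section lift

variable (α : ℝ) {f : UnitAddCircle → ℝ} {φ : UnitAddCircle × ℝ → ℂ}

/-- Invariance of lifts under the `ℤ`-action on `𝕋 × ℝ` whose quotient is the flow space. It
replaces a large height by a bounded one over another base point. -/
theorem lift_add_zsmul (hf : Continuous f) (hpos : ∀ x, 0 < f x) (φ : UnitAddCircle × ℝ → ℂ)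
    (m : ℤ) (x : UnitAddCircle) (v : ℝ) :
    lift α f φ (x + m • (α : UnitAddCircle)) (v - birkhoff α f m x) = lift α f φ x v := by
  have hc : crossings α f (x + m • (α : UnitAddCircle)) (v - birkhoff α f m x)
      = crossings α f x v - m := by
    rw [crossings_eq_iff α hf hpos]
    have h := crossings_spec α hf hpos x v
    have h1 := birkhoff_add α f m (crossings α f x v - m) x
    have h2 := birkhoff_add α f m (crossings α f x v - m + 1) x
    rw [show m + (crossings α f x v - m) = crossings α f x v by ring] at h1
    rw [show m + (crossings α f x v - m + 1) = crossings α f x v + 1 by ring] at h2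
    constructor <;> linarith [h.1, h.2]
  have h1 := birkhoff_add α f m (crossings α f x v - m) x
  rw [show m + (crossings α f x v - m) = crossings α f x v by ring] at h1
  unfold lift
  rw [hc, h1, add_assoc x, ← add_zsmul, show m + (crossings α f x v - m) = crossings α f x v by ring]
  congr 2
  ring

theorem lift_of_mem_Ico (hf : Continuous f) (hpos : ∀ x, 0 < f x) (φ : UnitAddCircle × ℝ → ℂ)
    {x : UnitAddCircle} {v : ℝ} (hv : v ∈ Set.Ico 0 (f x)) : lift α f φ x v = φ (x, v) := by
  have : crossings α f x v = 0 := by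
    rw [crossings_eq_iff α hf hpos, birkhoff_add_one, birkhoff_zero]
    simpa using hv
  simp [lift, this, birkhoff_zero]

theorem IsTest.eq_zero (hφ : IsTest f φ) {p : UnitAddCircle × ℝ} (h : p.2 ≤ 0 ∨ f p.1 ≤ p.2) :
    φ p = 0 := by
  by_contra h0
  have := hφ.support p h0
  rcases h with h | h <;> linarith

theorem IsTest.continuous_lift (hf : Continuous f) (hpos : ∀ x, 0 < f x) (hφ : IsTest f φ) :
    Continuous fun p : UnitAddCircle × ℝ => lift α f φ p.1 p.2 := by
  have hφc := hφ.continuous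
  refine continuous_iff_continuousAt.mpr fun p₀ => ?_
  set n := crossings α f p₀.1 p₀.2 with hn
  have hspec := crossings_spec α hf hpos p₀.1 p₀.2
  rw [← hn] at hspec
  have hb : ∀ m, Continuous (birkhoff α f m) := continuous_birkhoff α hf
  have hU : {p : UnitAddCircle × ℝ | birkhoff α f (n - 1) p.1 < p.2 ∧ p.2 < birkhoff α f (n + 1) p.1}
      ∈ 𝓝 p₀ := by
    refine IsOpen.mem_nhds ?_ ⟨(birkhoff_strictMono α hpos p₀.1 (sub_one_lt n)).trans_le hspec.1,
      hspec.2⟩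
    exact (isOpen_lt ((hb _).comp continuous_fst) continuous_snd).inter
      (isOpen_lt continuous_snd ((hb _).comp continuous_fst))
  -- Near `p₀` only the branches `n` and `n - 1` can occur. The inactive one is evaluated outside
  -- `(0, f)`, where `φ` vanishes, so the lift is locally the sum of the two.
  have hcont : Continuous fun p : UnitAddCircle × ℝ =>
      φ (p.1 + n • (α : UnitAddCircle), p.2 - birkhoff α f n p.1)
        + φ (p.1 + (n - 1) • (α : UnitAddCircle), p.2 - birkhoff α f (n - 1) p.1) := by
    have := hb n
    have := hb (n - 1)
    fun_prop
  refine hcont.continuousAt.congr ?_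
  filter_upwards [hU] with p hp
  have e := birkhoff_add_one α f (n - 1) p.1
  rw [sub_add_cancel] at e
  rcases le_or_gt (birkhoff α f n p.1) p.2 with h | h
  · have hc : crossings α f p.1 p.2 = n := (crossings_eq_iff α hf hpos).mpr ⟨h, hp.2⟩
    rw [lift, hc, hφ.eq_zero (p := (p.1 + (n - 1) • (α : UnitAddCircle), _)), add_zero]
    right
    simp only
    linarith
  · have hc : crossings α f p.1 p.2 = n - 1 :=
      (crossings_eq_iff α hf hpos).mpr ⟨hp.1.le, by rwa [sub_add_cancel]⟩
    rw [lift, hc, hφ.eq_zero (p := (p.1 + n • (α : UnitAddCircle), _)), zero_add]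
    left
    simp only
    linarith

theorem exists_roof_bound (hf : Continuous f) (hpos : ∀ x, 0 < f x) :
    ∃ m M : ℝ, 0 < m ∧ 0 < M ∧ ∀ x, m ≤ f x ∧ f x ≤ M := by
  obtain ⟨y, -, hy⟩ := isCompact_univ.exists_isMinOn
    (Set.univ_nonempty (α := UnitAddCircle)) hf.continuousOn
  obtain ⟨z, -, hz⟩ := isCompact_univ.exists_isMaxOn
    (Set.univ_nonempty (α := UnitAddCircle)) hf.continuousOn
  exact ⟨f y, f z, hpos y, hpos z, fun x => ⟨hy (Set.mem_univ x), hz (Set.mem_univ x)⟩⟩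

theorem IsTest.exists_bound (hf : Continuous f) (hpos : ∀ x, 0 < f x) (hφ : IsTest f φ) :
    ∃ C : ℝ, 0 < C ∧ ∀ p, ‖φ p‖ ≤ C := by
  obtain ⟨m, M, -, -, hM⟩ := exists_roof_bound hf hpos
  obtain ⟨C, hC⟩ := (isCompact_univ.prod (isCompact_Icc (a := (0 : ℝ)) (b := M))
    ).exists_bound_of_continuousOn (f := φ) hφ.continuous.continuousOn
  refine ⟨max C 1, by positivity, fun p => ?_⟩
  by_cases h : φ p = 0
  · rw [h, norm_zero]; positivity
  · have := hφ.support p h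
    exact (hC p ⟨Set.mem_univ _, this.1.le, this.2.le.trans (hM p.1).2⟩).trans (le_max_left _ _)

end lift

/-! ### Uniform ergodic averages -/

theorem integral_fourier_of_ne_zero {k : ℤ} (hk : k ≠ 0) :
    ∫ x : UnitAddCircle, (fourier k x : ℂ) = 0 :=
  integral_eq_zero_of_add_right_eq_neg (fourier_add_half_inv_index hk (by norm_num))

theorem fourier_ne_one_of_irrational {α : ℝ} (hα : Irrational α) {k : ℤ} (hk : k ≠ 0) :
    (fourier k (α : UnitAddCircle) : ℂ) ≠ 1 := by
  rw [fourier_coe_eq_exp, Ne, Complex.exp_eq_one_iff]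
  rintro ⟨m, hm⟩
  have h : (k : ℝ) * α = m := by
    have h1 : (2 * Real.pi * Complex.I) * ((k * α : ℝ) : ℂ) = (2 * Real.pi * Complex.I) * (m : ℝ) := by
      push_cast at hm ⊢
      linear_combination hm
    exact_mod_cast mul_left_cancel₀ Complex.two_pi_I_ne_zero h1
  exact (hα.intCast_mul hk) ⟨m, by rw [h]; simp⟩

/-- Weyl equidistribution for an irrational rotation, uniformly in the starting point. -/
theorem norm_sum_rotation_sub_le {α : ℝ} (hα : Irrational α) (H : C(UnitAddCircle, ℂ)) {ε : ℝ}
    (hε : 0 < ε) : ∃ C : ℝ, 0 ≤ C ∧ ∀ (n : ℕ) (x : UnitAddCircle),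
      ‖∑ i ∈ Finset.range n, H (x + i • (α : UnitAddCircle)) - n * ∫ y, H y‖ ≤ ε * n + C := by
  have hint : ∀ P : C(UnitAddCircle, ℂ), Integrable P volume := fun P =>
    P.continuous.integrable_of_hasCompactSupport (HasCompactSupport.of_compactSpace _)
  -- For trigonometric polynomials the error is bounded independently of `n`; the term `ε n` arises
  -- only from uniform approximation of `H`.
  have hspan : ∀ P ∈ Submodule.span ℂ (Set.range (@fourier 1)), ∃ C : ℝ, 0 ≤ C ∧
      ∀ (n : ℕ) (x : UnitAddCircle),
      ‖∑ i ∈ Finset.range n, P (x + i • (α : UnitAddCircle)) - n * ∫ y, P y‖ ≤ C := by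
    intro P hP
    induction hP using Submodule.span_induction with
    | mem P hP =>
      obtain ⟨k, rfl⟩ := hP
      rcases eq_or_ne k 0 with rfl | hk
      · exact ⟨0, le_rfl, fun n x => by simp [measureReal_def]⟩
      · refine ⟨2 / ‖(fourier k (α : UnitAddCircle) : ℂ) - 1‖, by positivity, fun n x => ?_⟩
        have hz : 0 < ‖(fourier k (α : UnitAddCircle) : ℂ) - 1‖ :=
          norm_pos_iff.mpr (sub_ne_zero.mpr (fourier_ne_one_of_irrational hα hk))
        rw [integral_fourier_of_ne_zero hk, mul_zero, sub_zero]
        simp_rw [fourier_add_arg, fourier_nsmul_arg]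
        rw [← Finset.mul_sum, norm_mul, norm_fourier_apply, one_mul, le_div_iff₀ hz]
        exact norm_geom_sum_mul_le (norm_fourier_apply _ _) n
    | zero => exact ⟨0, le_rfl, fun n x => by simp⟩
    | add P R _ _ hP hR =>
      obtain ⟨C, hC0, hC⟩ := hP
      obtain ⟨D, hD0, hD⟩ := hR
      refine ⟨C + D, by positivity, fun n x => ?_⟩
      refine le_trans (le_of_eq ?_) ((norm_add_le _ _).trans (add_le_add (hC n x) (hD n x)))
      simp only [ContinuousMap.add_apply]
      rw [integral_add (hint P) (hint R), Finset.sum_add_distrib]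
      congr 1; ring
    | smul c P _ hP =>
      obtain ⟨C, hC0, hC⟩ := hP
      refine ⟨‖c‖ * C, by positivity, fun n x => ?_⟩
      refine le_trans (le_of_eq ?_) (mul_le_mul_of_nonneg_left (hC n x) (norm_nonneg c))
      simp only [ContinuousMap.smul_apply, smul_eq_mul]
      rw [integral_const_mul, ← Finset.mul_sum, ← norm_mul]
      congr 1; ring
  have hmem : H ∈ closure (Submodule.span ℂ (Set.range (@fourier 1)) : Set C(UnitAddCircle, ℂ)) := by
    rw [← Submodule.topologicalClosure_coe, span_fourier_closure_eq_top]; trivial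
  obtain ⟨P, hP, hHP⟩ := Metric.mem_closure_iff.mp hmem (ε / 2) (by positivity)
  obtain ⟨C, hC0, hC⟩ := hspan P hP
  refine ⟨C, hC0, fun n x => ?_⟩
  have hd : ∀ y, ‖H y - P y‖ ≤ ε / 2 := fun y => by
    rw [← dist_eq_norm]; exact (ContinuousMap.dist_apply_le_dist y).trans hHP.le
  have h1 : ‖∑ i ∈ Finset.range n, (H (x + i • (α : UnitAddCircle)) - P (x + i • (α : UnitAddCircle)))‖
      ≤ ε / 2 * n := by
    refine (norm_sum_le _ _).trans ((Finset.sum_le_sum fun i _ => hd _).trans (le_of_eq ?_))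
    simp; ring
  have h2 : ‖(n : ℂ) * ∫ y, (H y - P y)‖ ≤ ε / 2 * n := by
    rw [norm_mul, Complex.norm_natCast, mul_comm]
    gcongr
    refine (norm_integral_le_of_norm_le_const (C := ε / 2) (Eventually.of_forall hd)).trans ?_
    simp [measureReal_def]
  rw [Finset.sum_sub_distrib] at h1
  rw [integral_sub (hint H) (hint P)] at h2
  have e : ∑ i ∈ Finset.range n, H (x + i • (α : UnitAddCircle)) - n * ∫ y, H y
      = (∑ i ∈ Finset.range n, H (x + i • (α : UnitAddCircle))
          - ∑ i ∈ Finset.range n, P (x + i • (α : UnitAddCircle)))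
        - n * ((∫ y, H y) - ∫ y, P y)
        + (∑ i ∈ Finset.range n, P (x + i • (α : UnitAddCircle)) - n * ∫ y, P y) := by ring
  rw [e]
  refine (norm_add_le _ _).trans ?_
  have := norm_sub_le (∑ i ∈ Finset.range n, H (x + i • (α : UnitAddCircle))
          - ∑ i ∈ Finset.range n, P (x + i • (α : UnitAddCircle))) (n * ((∫ y, H y) - ∫ y, P y))
  linarith [hC n x]

/-! ### Integrals of lifts along orbits and uniform time averages of the flow -/

section

variable {f : UnitAddCircle → ℝ} {φ : UnitAddCircle × ℝ → ℂ}

theorem IsTest.integrable (hf : Continuous f) (hpos : ∀ x, 0 < f x) (hφ : IsTest f φ) :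
    Integrable φ volume := by
  obtain ⟨m, M, -, -, hM⟩ := exists_roof_bound hf hpos
  refine hφ.continuous.integrable_of_hasCompactSupport (HasCompactSupport.intro
    (isCompact_univ.prod (isCompact_Icc (a := (0 : ℝ)) (b := M))) fun p hp => ?_)
  by_contra h
  have := hφ.support p h
  exact hp ⟨Set.mem_univ _, this.1.le, this.2.le.trans (hM p.1).2⟩

theorem IsTest.integral_flowMeasure (hφ : IsTest f φ) :
    ∫ p, φ p ∂flowMeasure f = ∫ p, φ p := by
  refine setIntegral_eq_integral_of_forall_compl_eq_zero fun p hp => ?_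
  by_contra h
  have := hφ.support p h
  exact hp ⟨this.1.le, this.2⟩

/-- The integral of a lift along the fibre over `x`. -/
def fibreIntegral (α : ℝ) (f : UnitAddCircle → ℝ) (φ : UnitAddCircle × ℝ → ℂ) (x : UnitAddCircle) :
    ℂ :=
  ∫ v in (0 : ℝ)..f x, lift α f φ x v

variable (α : ℝ)

theorem IsTest.continuous_fibreIntegral (hf : Continuous f) (hpos : ∀ x, 0 < f x)
    (hφ : IsTest f φ) : Continuous (fibreIntegral α f φ) :=
  intervalIntegral.continuous_parametric_intervalIntegral_of_continuous
    (hφ.continuous_lift α hf hpos) hf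

theorem IsTest.integral_fibreIntegral (hf : Continuous f) (hpos : ∀ x, 0 < f x)
    (hφ : IsTest f φ) : ∫ x, fibreIntegral α f φ x = ∫ p, φ p ∂flowMeasure f := by
  rw [hφ.integral_flowMeasure, Measure.volume_eq_prod,
    integral_prod _ (by rw [← Measure.volume_eq_prod]; exact hφ.integrable hf hpos)]
  congr 1
  ext x
  rw [fibreIntegral, intervalIntegral.integral_of_le (hpos x).le, integral_Ioc_eq_integral_Ioo,
    setIntegral_congr_fun (g := fun v => φ (x, v)) measurableSet_Ioo
      fun v hv => lift_of_mem_Ico α hf hpos φ ⟨hv.1.le, hv.2⟩]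
  refine setIntegral_eq_integral_of_forall_compl_eq_zero fun v hv => ?_
  by_contra h
  exact hv (hφ.support _ h)

theorem IsTest.continuous_lift_right (hf : Continuous f) (hpos : ∀ x, 0 < f x) (hφ : IsTest f φ)
    (x : UnitAddCircle) : Continuous (lift α f φ x) :=
  Continuous.comp (g := fun p : UnitAddCircle × ℝ => lift α f φ p.1 p.2) (f := fun v => (x, v))
    (hφ.continuous_lift α hf hpos) (by fun_prop)

theorem integral_lift_shift (hf : Continuous f) (hpos : ∀ x, 0 < f x) (φ : UnitAddCircle × ℝ → ℂ)
    (n : ℤ) (x : UnitAddCircle) (a b : ℝ) :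
    ∫ v in a..b, lift α f φ x v = ∫ v in (a - birkhoff α f n x)..(b - birkhoff α f n x),
      lift α f φ (x + n • (α : UnitAddCircle)) v := by
  rw [← intervalIntegral.integral_comp_sub_right]
  simp_rw [lift_add_zsmul α hf hpos]

theorem IsTest.integral_lift_birkhoff (hf : Continuous f) (hpos : ∀ x, 0 < f x) (hφ : IsTest f φ)
    (n : ℕ) (x : UnitAddCircle) :
    ∫ v in (0 : ℝ)..birkhoff α f n x, lift α f φ x v
      = ∑ i ∈ Finset.range n, fibreIntegral α f φ (x + i • (α : UnitAddCircle)) := by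
  have hc := hφ.continuous_lift_right α hf hpos x
  induction n with
  | zero => simp [birkhoff_zero]
  | succ n ih =>
    rw [Finset.sum_range_succ, ← ih, ← intervalIntegral.integral_add_adjacent_intervals
      (hc.intervalIntegrable _ _) (hc.intervalIntegrable (birkhoff α f n x) _),
      integral_lift_shift α hf hpos φ n x (birkhoff α f n x)]
    push_cast
    rw [birkhoff_add_one, sub_self, add_sub_cancel_left, natCast_zsmul]
    rfl

theorem natCast_mul_le_birkhoff {m : ℝ} (hm : ∀ x, m ≤ f x) (n : ℕ) (x : UnitAddCircle) :
    n * m ≤ birkhoff α f n x := by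
  rw [birkhoff_natCast]
  simpa using Finset.sum_le_sum fun i (_ : i ∈ Finset.range n) => hm (x + i • (α : UnitAddCircle))

theorem birkhoff_le_natCast_mul {M : ℝ} (hM : ∀ x, f x ≤ M) (n : ℕ) (x : UnitAddCircle) :
    birkhoff α f n x ≤ n * M := by
  rw [birkhoff_natCast]
  simpa using Finset.sum_le_sum fun i (_ : i ∈ Finset.range n) => hM (x + i • (α : UnitAddCircle))

theorem crossings_nonneg (hf : Continuous f) (hpos : ∀ x, 0 < f x) (x : UnitAddCircle) {s : ℝ}
    (hs : 0 ≤ s) : 0 ≤ crossings α f x s := by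
  by_contra h
  have h1 := (crossings_spec α hf hpos x s).2
  have h2 := (birkhoff_strictMono α hpos x).monotone
    (show crossings α f x s + 1 ≤ 0 by omega)
  simp only [birkhoff_zero] at h2
  linarith

variable {α}

theorem IsTest.norm_integral_lift_sub_le_of_zero (hα : Irrational α) (hf : Continuous f)
    (hpos : ∀ x, 0 < f x) (hint : ∫ x, f x = 1) (hφ : IsTest f φ) {ε : ℝ} (hε : 0 < ε) :
    ∃ C : ℝ, 0 ≤ C ∧ ∀ (x : UnitAddCircle) (L : ℝ), 0 ≤ L →
      ‖(∫ v in (0 : ℝ)..L, lift α f φ x v) - L * ∫ p, φ p ∂flowMeasure f‖ ≤ ε * L + C := by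
  obtain ⟨m, M, hm0, hM0, hmM⟩ := exists_roof_bound hf hpos
  obtain ⟨K, hK0, hK⟩ := hφ.exists_bound hf hpos
  set c : ℂ := ∫ p, φ p ∂flowMeasure f with hc
  have hfc : Continuous fun x => (f x : ℂ) := Complex.continuous_ofReal.comp hf
  have hG := hφ.continuous_fibreIntegral α hf hpos
  have hi1 : Integrable (fibreIntegral α f φ) volume :=
    hG.integrable_of_hasCompactSupport (HasCompactSupport.of_compactSpace _)
  have hi2 : Integrable (fun x => c * (f x : ℂ)) volume :=
    (continuous_const.mul hfc).integrable_of_hasCompactSupport (HasCompactSupport.of_compactSpace _)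
  -- Birkhoff sums of `H` are the integral of the lift minus `c` times the elapsed time, taken up to
  -- a crossing; `H` has mean zero because `∫ f = 1`.
  set H : C(UnitAddCircle, ℂ) := ⟨fun x => fibreIntegral α f φ x - c * f x, by fun_prop⟩ with hH
  have hH0 : ∫ x, H x = 0 := by
    change ∫ x, (fibreIntegral α f φ x - c * f x) = 0
    rw [integral_sub hi1 hi2, hφ.integral_fibreIntegral α hf hpos, integral_const_mul,
      integral_complex_ofReal, hint]
    simp [hc]
  -- The factor `m` converts steps into time: `n` crossings take time at least `n m`. The unfinished
  -- last crossing takes at most `M`.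
  obtain ⟨C, hC0, hC⟩ := norm_sum_rotation_sub_le hα H (ε := ε * m) (by positivity)
  refine ⟨C + M * (K + ‖c‖), by positivity, fun x L hL => ?_⟩
  obtain ⟨n, hn⟩ := Int.eq_ofNat_of_zero_le (crossings_nonneg α hf hpos x hL)
  have hspec := crossings_spec α hf hpos x L
  rw [hn, birkhoff_add_one] at hspec
  set s := birkhoff α f n x with hs
  have hcl := hφ.continuous_lift_right α hf hpos x
  have hLs : L - s ≤ M := by linarith [hspec.2, (hmM (x + (n : ℤ) • (α : UnitAddCircle))).2]
  have h1 : ‖∫ v in s..L, lift α f φ x v‖ ≤ K * M := by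
    refine (intervalIntegral.norm_integral_le_of_norm_le_const (C := K) fun v _ => hK _).trans ?_
    rw [abs_of_nonneg (by linarith [hspec.1])]
    gcongr
  have h2 : ‖((L - s : ℝ) : ℂ) * c‖ ≤ M * ‖c‖ := by
    rw [norm_mul, Complex.norm_real, Real.norm_eq_abs, abs_of_nonneg (by linarith [hspec.1])]
    gcongr
  have h3 : (∫ v in (0 : ℝ)..s, lift α f φ x v) - s * c
      = ∑ i ∈ Finset.range n, H (x + i • (α : UnitAddCircle)) := by
    rw [hs, hφ.integral_lift_birkhoff α hf hpos, birkhoff_natCast]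
    change _ = ∑ i ∈ Finset.range n, (fibreIntegral α f φ _ - c * f _)
    rw [Finset.sum_sub_distrib, ← Finset.mul_sum]
    push_cast; ring
  have h4 := hC n x
  rw [hH0, mul_zero, sub_zero, ← h3] at h4
  have hnL : n * m ≤ L := (natCast_mul_le_birkhoff α (fun x => (hmM x).1) n x).trans hspec.1
  have e : (∫ v in (0 : ℝ)..L, lift α f φ x v) - L * c
      = ((∫ v in (0 : ℝ)..s, lift α f φ x v) - s * c) + (∫ v in s..L, lift α f φ x v)
        - ((L - s : ℝ) : ℂ) * c := by
    rw [← intervalIntegral.integral_add_adjacent_intervals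
      (hcl.intervalIntegrable 0 s) (hcl.intervalIntegrable s L)]
    push_cast; ring
  rw [e]
  refine (norm_sub_le _ _).trans (le_trans (add_le_add_left (norm_add_le _ _) _) ?_)
  nlinarith

/-- Ergodic averages of a test function along orbits of the special flow converge uniformly. -/
theorem IsTest.norm_integral_lift_sub_le (hα : Irrational α) (hf : Continuous f)
    (hpos : ∀ x, 0 < f x) (hint : ∫ x, f x = 1) (hφ : IsTest f φ) {ε : ℝ} (hε : 0 < ε) :
    ∃ C : ℝ, 0 ≤ C ∧ ∀ (x : UnitAddCircle) (v L : ℝ), 0 ≤ L →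
      ‖(∫ u in v..(v + L), lift α f φ x u) - L * ∫ p, φ p ∂flowMeasure f‖ ≤ ε * L + C := by
  obtain ⟨m, M, hm0, hM0, hmM⟩ := exists_roof_bound hf hpos
  obtain ⟨C, hC0, hC⟩ := hφ.norm_integral_lift_sub_le_of_zero hα hf hpos hint hε
  refine ⟨2 * ε * M + 2 * C, by positivity, fun x v L hL => ?_⟩
  set c : ℂ := ∫ p, φ p ∂flowMeasure f with hc
  set n := crossings α f x v with hn
  have hspec := crossings_spec α hf hpos x v
  rw [← hn, birkhoff_add_one] at hspec
  set y := x + n • (α : UnitAddCircle) with hy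
  have hcl := hφ.continuous_lift_right α hf hpos y
  -- The `ℤ`-action moves the starting height into `[0, M]`; the integral is then a difference of
  -- two integrals starting at `0`.
  obtain ⟨w, hw⟩ : ∃ w, w = v - birkhoff α f n x := ⟨_, rfl⟩
  have hw0 : 0 ≤ w := by linarith [hspec.1]
  have hwM : w ≤ M := by linarith [hspec.2, (hmM y).2]
  have e : (∫ u in v..(v + L), lift α f φ x u) - L * c
      = ((∫ u in (0 : ℝ)..(w + L), lift α f φ y u) - (w + L : ℝ) * c)
        - ((∫ u in (0 : ℝ)..w, lift α f φ y u) - w * c) := by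
    rw [integral_lift_shift α hf hpos φ n x, ← hw, show v + L - birkhoff α f n x = w + L by linarith,
      ← intervalIntegral.integral_add_adjacent_intervals
      (hcl.intervalIntegrable 0 w) (hcl.intervalIntegrable w (w + L))]
    push_cast; ring
  rw [e]
  refine (norm_sub_le _ _).trans ((add_le_add (hC y _ (by positivity)) (hC y w hw0)).trans ?_)
  nlinarith

end

/-! ### Resonant times -/

/-- Times `t_n → ∞` and frequencies `q_n` such that `q_n` dominates the Birkhoff sums of `f` up to
times of order `t_n`: `q_n α` is within `1 / Q_n` of an integer, where `t_n / Q_n → 0`. -/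
structure IsResonant (α : ℝ) (f : UnitAddCircle → ℝ) (t : ℕ → ℝ) (q : ℕ → ℕ) (Q : ℕ → ℝ) :
    Prop where
  freq_pos : ∀ n, 0 < q n
  Q_pos : ∀ n, 0 < Q n
  t_pos : ∀ n, 0 < t n
  approx : ∀ n, ∃ p : ℤ, IsCoprime p (q n) ∧ |α - p / q n| ≤ 1 / (q n * Q n)
  coeff_ne_zero : ∀ n, coeff f (q n) ≠ 0
  tendsto_time : Tendsto t atTop atTop
  tendsto_tail : Tendsto (fun n => fourierTail f (q n) / ‖coeff f (q n)‖) atTop (𝓝 0)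
  tendsto_amplitude : Tendsto (fun n => t n * ‖coeff f (q n)‖) atTop atTop
  tendsto_ratio : Tendsto (fun n => t n / Q n) atTop (𝓝 0)

theorem fourierTail_nonneg (f : UnitAddCircle → ℝ) (n : ℕ) : 0 ≤ fourierTail f n :=
  tsum_nonneg fun _ => by positivity

section resonant

variable {α : ℝ} {f : UnitAddCircle → ℝ} {t : ℕ → ℝ} {q : ℕ → ℕ} {Q : ℕ → ℝ}

theorem IsResonant.eventually_increment (hr : IsResonant α f t q Q) (hf : IsRealAnalytic f)
    {S C ε : ℝ} (hS : 0 < S) (hC : 0 < C) (hε : 0 < ε) :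
    ∀ᶠ j in atTop, ∀ n : ℕ, n ≤ C * t j → ∀ (x : UnitAddCircle) (h : ℝ),
      |h| ≤ S / (t j * ‖coeff f (q j)‖ * q j) →
      |birkhoff α f n (x + h) - birkhoff α f n x
        + 4 * Real.pi * q j * h * n * (coeff f (q j) * fourier (q j : ℤ) x).im| ≤ ε := by
  set A := ∑' k : ℤ, ‖coeff f k‖ * |(k : ℝ)| with hA
  set B := ∑' k : ℤ, ‖coeff f k‖ * |(k : ℝ)| ^ 2 with hB
  have hA0 : 0 ≤ A := tsum_nonneg fun _ => by positivity
  have hB0 : 0 ≤ B := tsum_nonneg fun _ => by positivity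
  have hu : Tendsto (fun j => (t j * ‖coeff f (q j)‖)⁻¹) atTop (𝓝 0) :=
    tendsto_inv_atTop_zero.comp hr.tendsto_amplitude
  -- The error of `abs_birkhoff_increment_le` after inserting `n ≤ C t` and `q |h| ≤ S/(t a)`: every
  -- term carries a factor `T_q/a`, `1/(t a)` or `t/Q`.
  have hlim : Tendsto (fun j =>
      4 * Real.pi * S * C * (fourierTail f (q j) / ‖coeff f (q j)‖)
      + 2 * Real.pi * S * A * (t j * ‖coeff f (q j)‖)⁻¹
      + 8 * Real.pi * S * C * B * ((t j / Q j) * (t j * ‖coeff f (q j)‖)⁻¹)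
      + 8 * Real.pi ^ 2 * S * C ^ 2 * (t j / Q j)
      + 8 * Real.pi ^ 2 * S ^ 2 * C * (t j * ‖coeff f (q j)‖)⁻¹) atTop (𝓝 0) := by
    have := ((((hr.tendsto_tail.const_mul (4 * Real.pi * S * C)).add
      (hu.const_mul (2 * Real.pi * S * A))).add
      ((hr.tendsto_ratio.mul hu).const_mul (8 * Real.pi * S * C * B))).add
      (hr.tendsto_ratio.const_mul (8 * Real.pi ^ 2 * S * C ^ 2))).add
      (hu.const_mul (8 * Real.pi ^ 2 * S ^ 2 * C))
    simpa using this
  have hsmall : Tendsto (fun j => 2 * Real.pi * S * (t j * ‖coeff f (q j)‖)⁻¹) atTop (𝓝 0) := by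
    simpa using hu.const_mul (2 * Real.pi * S)
  filter_upwards [hlim.eventually_le_const hε, hsmall.eventually_le_const zero_lt_one]
    with j hj1 hj2 n hn x h hh
  obtain ⟨p, hp, hpq⟩ := hr.approx j
  have hq0 : (0 : ℝ) < q j := by exact_mod_cast hr.freq_pos j
  have hq1 : (1 : ℝ) ≤ q j := by exact_mod_cast hr.freq_pos j
  have ht0 := hr.t_pos j
  have hQ0 := hr.Q_pos j
  have ha0 : 0 < ‖coeff f (q j)‖ := norm_pos_iff.mpr (hr.coeff_ne_zero j)
  have hT0 := fourierTail_nonneg f (q j)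
  set a := ‖coeff f (q j)‖ with ha
  set T := fourierTail f (q j) with hT
  have hqh : q j * |h| ≤ S * (t j * a)⁻¹ := by
    calc q j * |h| ≤ q j * (S / (t j * a * q j)) := by gcongr
      _ = S * (t j * a)⁻¹ := by field_simp
  have hh' : |h| ≤ S * (t j * a)⁻¹ := (le_mul_of_one_le_left (abs_nonneg h) hq1).trans hqh
  have hqh1 : 2 * Real.pi * (q j * |h|) ≤ 1 := by
    refine le_trans ?_ hj2
    rw [mul_assoc (2 * Real.pi)]
    gcongr
  refine (abs_birkhoff_increment_le hf (hr.freq_pos j) hQ0 hp hpq n hqh1 x).trans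
    (le_trans ?_ hj1)
  rw [← ha, ← hT, ← hA, ← hB]
  have h1 : 2 * Real.pi * |h| * (n * (2 * T) + q j * A + n * (4 / Q j) * B)
      ≤ 4 * Real.pi * S * C * (T / a) + 2 * Real.pi * S * A * (t j * a)⁻¹
        + 8 * Real.pi * S * C * B * ((t j / Q j) * (t j * a)⁻¹) := by
    calc 2 * Real.pi * |h| * (n * (2 * T) + q j * A + n * (4 / Q j) * B)
        = 2 * Real.pi * (n * (2 * T) * |h| + A * (q j * |h|) + n * (4 / Q j) * B * |h|) := by ring
      _ ≤ 2 * Real.pi * (C * t j * (2 * T) * (S * (t j * a)⁻¹) + A * (S * (t j * a)⁻¹)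
          + C * t j * (4 / Q j) * B * (S * (t j * a)⁻¹)) := by gcongr
      _ = _ := by field_simp; ring
  have h2 : 2 * (a * (n ^ 2 * (2 * Real.pi / Q j) * (2 * Real.pi * (q j * |h|))
        + n * (2 * Real.pi * (q j * |h|)) ^ 2))
      ≤ 8 * Real.pi ^ 2 * S * C ^ 2 * (t j / Q j)
        + 8 * Real.pi ^ 2 * S ^ 2 * C * (t j * a)⁻¹ := by
    calc _ ≤ 2 * (a * ((C * t j) ^ 2 * (2 * Real.pi / Q j) * (2 * Real.pi * (S * (t j * a)⁻¹))
        + C * t j * (2 * Real.pi * (S * (t j * a)⁻¹)) ^ 2)) := by gcongr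
      _ = _ := by field_simp; ring
  linarith

end resonant

theorem norm_coe_le_abs (h : ℝ) : ‖(h : UnitAddCircle)‖ ≤ |h| := by
  rw [UnitAddCircle.norm_eq]
  simpa using round_le h 0

/-! ### The set of points where the shear is small -/

/-- The sets decrease to the zero set of the imaginary part, contained in the preimage of `{1, -1}`
and so finite. -/
theorem exists_volume_im_fourier_lt {ε : ℝ} (hε : 0 < ε) :
    ∃ δ > 0, volume.real {y : UnitAddCircle | |(fourier 1 y : ℂ).im| < δ} ≤ ε := by
  have hcont : Continuous fun y : UnitAddCircle => |(fourier 1 y : ℂ).im| := by fun_prop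
  have hzero : volume {y : UnitAddCircle | (fourier 1 y : ℂ).im = 0} = 0 := by
    have : NullSingletonClass (volume : Measure UnitAddCircle) := ⟨fun x => by
      rw [← Metric.closedBall_zero, AddCircle.volume_closedBall]; simp⟩
    refine Set.Finite.measure_zero ?_ _
    refine ((Set.toFinite {(1 : ℂ), -1}).preimage (f := fun y : UnitAddCircle => (fourier 1 y : ℂ))
      ?_).subset fun y hy => ?_
    · intro y _ z _ h
      simp only [fourier_apply, one_zsmul] at h
      exact AddCircle.injective_toCircle one_ne_zero (Subtype.ext h)
    · have h1 := norm_fourier_apply 1 y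
      change (fourier 1 y : ℂ).im = 0 at hy
      have h2 : (fourier 1 y : ℂ) = ((fourier 1 y : ℂ).re : ℂ) :=
        Complex.ext (by simp) (by simpa using hy)
      rw [h2, Complex.norm_real, Real.norm_eq_abs] at h1
      rcases eq_or_eq_neg_of_abs_eq h1 with h | h <;> rw [h] at h2
      · left; simpa using h2
      · right; simpa using h2
  have hanti : Antitone fun n : ℕ => {y : UnitAddCircle | |(fourier 1 y : ℂ).im| < 1 / ((n : ℝ) + 1)} :=
    fun n m hnm y (hy : |(fourier 1 y : ℂ).im| < 1 / ((m : ℝ) + 1)) =>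
      hy.trans_le (Nat.one_div_le_one_div hnm)
  have hlim := tendsto_measure_iInter_atTop (μ := (volume : Measure UnitAddCircle))
    (fun n => (measurableSet_lt hcont.measurable measurable_const).nullMeasurableSet) hanti
    ⟨0, measure_ne_top _ _⟩
  have hI : ⋂ n : ℕ, {y : UnitAddCircle | |(fourier 1 y : ℂ).im| < 1 / ((n : ℝ) + 1)}
      = {y : UnitAddCircle | (fourier 1 y : ℂ).im = 0} := by
    ext y
    simp only [Set.mem_iInter, Set.mem_ofPred_eq]
    constructor
    · intro h
      by_contra h0
      obtain ⟨n, hn⟩ := exists_nat_one_div_lt (abs_pos.mpr h0)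
      exact lt_asymm hn (h n)
    · intro h n
      rw [h, abs_zero]; positivity
  rw [hI, hzero] at hlim
  obtain ⟨n, hn⟩ := ((ENNReal.tendsto_nhds_zero.mp hlim) (ENNReal.ofReal ε) (by simpa)).exists
  exact ⟨1 / ((n : ℝ) + 1), by positivity, ENNReal.toReal_le_of_le_ofReal hε.le hn⟩

/-- With `c = e(θ)`, the map `x ↦ qx + θ` preserves Lebesgue measure. So the size of the exceptional
set does not depend on `q`, and `δ` can be fixed before the time. -/
theorem volume_im_mul_fourier_lt {c : ℂ} (hc : ‖c‖ = 1) {q : ℕ} (hq : 0 < q) (δ : ℝ) :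
    volume.real {x : UnitAddCircle | |(c * fourier (q : ℤ) x).im| < δ}
      = volume.real {y : UnitAddCircle | |(fourier 1 y : ℂ).im| < δ} := by
  obtain ⟨θ, hθ⟩ := (AddCircle.homeomorphCircle (one_ne_zero (α := ℝ))).surjective
    ⟨c, mem_sphere_zero_iff_norm.mpr hc⟩
  rw [AddCircle.homeomorphCircle_apply] at hθ
  replace hθ : (AddCircle.toCircle θ : ℂ) = c := by rw [hθ]
  have hmp : MeasurePreserving (fun y : UnitAddCircle => q • y + θ) volume volume := by
    rcases Nat.lt_or_ge 1 q with h | h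
    · exact (AddCircle.ergodic_nsmul_add θ h).toMeasurePreserving
    · have : q = 1 := by omega
      subst this
      simpa using measurePreserving_add_right (volume : Measure UnitAddCircle) θ
  have hcont : Continuous fun y : UnitAddCircle => |(fourier 1 y : ℂ).im| := by fun_prop
  have hm : MeasurableSet {y : UnitAddCircle | |(fourier 1 y : ℂ).im| < δ} :=
    measurableSet_lt hcont.measurable measurable_const
  rw [← hmp.measureReal_preimage hm.nullMeasurableSet]
  congr 1
  ext x
  have hx : (fourier 1 (q • x + θ) : ℂ) = c * fourier (q : ℤ) x := by
    rw [fourier_apply, fourier_apply, one_zsmul, AddCircle.toCircle_add, natCast_zsmul, Circle.coe_mul,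
      hθ, mul_comm]
  simp only [Set.mem_ofPred_eq, Set.mem_preimage, hx]

/-! ### Correlations of test functions -/

section correlation

variable {α : ℝ} {f : UnitAddCircle → ℝ} {φ ψ : UnitAddCircle × ℝ → ℂ}

/-- The substitution `u = v + ws` gives a time average over length `|w|`; a negative `w` merely
reverses the interval. -/
theorem norm_integral_comp_add_mul_sub_le {g : ℝ → ℂ} {c : ℂ} {ε C : ℝ}
    (hg : ∀ v L, 0 ≤ L → ‖(∫ u in v..(v + L), g u) - L * c‖ ≤ ε * L + C) (v : ℝ) {w : ℝ}
    (hw : w ≠ 0) : ‖(∫ s in (0 : ℝ)..1, g (v + w * s)) - c‖ ≤ ε + C / |w| := by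
  have key : ∀ (v : ℝ) {L : ℝ}, 0 < L →
      ‖(L⁻¹ : ℂ) * (∫ u in v..(v + L), g u) - c‖ ≤ ε + C / L := by
    intro v L hL
    have hL' : (L : ℂ) ≠ 0 := by exact_mod_cast hL.ne'
    have e : (L⁻¹ : ℂ) * (∫ u in v..(v + L), g u) - c
        = (L⁻¹ : ℂ) * ((∫ u in v..(v + L), g u) - L * c) := by
      field_simp
    rw [e, norm_mul, norm_inv, Complex.norm_real, Real.norm_eq_abs, abs_of_pos hL,
      inv_mul_le_iff₀ hL]
    refine (hg v L hL.le).trans (le_of_eq ?_)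
    field_simp
  rw [intervalIntegral.integral_comp_add_mul _ hw, mul_zero, add_zero, mul_one,
    Complex.real_smul, Complex.ofReal_inv]
  rcases lt_or_gt_of_ne hw with h | h
  · rw [intervalIntegral.integral_symm, abs_of_neg h]
    have := key (v + w) (neg_pos.mpr h)
    rw [add_neg_cancel_right] at this
    convert this using 3
    push_cast
    rw [inv_neg]; ring
  · rw [abs_of_pos h]
    exact key v h

theorem uniform_lift (hf : Continuous f) (hpos : ∀ x, 0 < f x) (hφ : IsTest f φ) (K : ℝ)
    {ε : ℝ} (hε : 0 < ε) : ∃ δ > 0, ∀ (x y : UnitAddCircle) (u v : ℝ), |u| ≤ K → |v| ≤ K →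
      ‖x - y‖ < δ → |u - v| < δ → ‖lift α f φ x u - lift α f φ y v‖ < ε := by
  have hc := (isCompact_univ.prod (isCompact_Icc (a := -K) (b := K))
    ).uniformContinuousOn_of_continuous
    (f := fun p : UnitAddCircle × ℝ => lift α f φ p.1 p.2)
    (hφ.continuous_lift α hf hpos).continuousOn
  obtain ⟨δ, hδ, h⟩ := Metric.uniformContinuousOn_iff.mp hc ε hε
  refine ⟨δ, hδ, fun x y u v hu hv hxy huv => ?_⟩
  have := h (x, u) ⟨Set.mem_univ _, abs_le.mp hu⟩ (y, v) ⟨Set.mem_univ _, abs_le.mp hv⟩ (by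
    rw [Prod.dist_eq, dist_eq_norm, Real.dist_eq]; exact max_lt hxy huv)
  rwa [dist_eq_norm] at this

theorem IsTest.uniform (hf : Continuous f) (hpos : ∀ x, 0 < f x) (hψ : IsTest f ψ)
    {ε : ℝ} (hε : 0 < ε) : ∃ δ > 0, ∀ (x y : UnitAddCircle) (r : ℝ), ‖x - y‖ < δ →
      ‖ψ (x, r) - ψ (y, r)‖ < ε := by
  obtain ⟨m, M, -, -, hM⟩ := exists_roof_bound hf hpos
  have hu : UniformContinuous ψ := by
    refine HasCompactSupport.uniformContinuous_of_continuous (HasCompactSupport.intro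
      (isCompact_univ.prod (isCompact_Icc (a := (0 : ℝ)) (b := M))) fun p hp => ?_) hψ.continuous
    by_contra h
    have := hψ.support p h
    exact hp ⟨Set.mem_univ _, this.1.le, this.2.le.trans (hM p.1).2⟩
  obtain ⟨δ, hδ, h⟩ := Metric.uniformContinuous_iff.mp hu ε hε
  refine ⟨δ, hδ, fun x y r hxy => ?_⟩
  have := @h (x, r) (y, r) (by
    rw [Prod.dist_eq, dist_eq_norm, dist_self]; exact max_lt hxy hδ)
  rwa [dist_eq_norm] at this

/-- The number of crossings up to time `t` is comparable to `t`. -/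
theorem crossings_bounds (hf : Continuous f) (hpos : ∀ x, 0 < f x) {m M : ℝ} (hm : 0 < m)
    (hM : 0 < M) (hmM : ∀ x, m ≤ f x ∧ f x ≤ M) {t r : ℝ} (ht : 2 * M ≤ t)
    (hr : r ∈ Set.Icc 0 M) (x : UnitAddCircle) :
    ∃ n : ℕ, crossings α f x (r + t) = n ∧ n ≤ 2 / m * t ∧ 1 / (2 * M) * t ≤ n ∧
      0 ≤ r + t - birkhoff α f n x ∧ r + t - birkhoff α f n x ≤ M := by
  have ht0 : 0 ≤ r + t := by linarith [hr.1]
  obtain ⟨n, hn⟩ := Int.eq_ofNat_of_zero_le (crossings_nonneg α hf hpos x ht0)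
  have hspec := crossings_spec α hf hpos x (r + t)
  have h2 := birkhoff_le_natCast_mul α (fun x => (hmM x).2) (n + 1) x
  push_cast at h2
  rw [hn] at hspec
  refine ⟨n, hn, ?_, ?_, by linarith [hspec.1], ?_⟩
  · have h1 := (natCast_mul_le_birkhoff α (fun x => (hmM x).1) n x).trans hspec.1
    rw [div_mul_eq_mul_div, le_div_iff₀ hm]
    linarith [hr.2]
  · rw [div_mul_eq_mul_div, div_le_iff₀ (by positivity)]
    nlinarith [hspec.2, hr.1]
  · rw [birkhoff_add_one] at hspec
    linarith [hspec.2, (hmM (x + (n : ℤ) • (α : UnitAddCircle))).2]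

variable {t : ℕ → ℝ} {q : ℕ → ℕ} {Q : ℕ → ℝ}

/-- The horizontal shift used at the `j`-th resonant time. -/
def shift (f : UnitAddCircle → ℝ) (t : ℕ → ℝ) (q : ℕ → ℕ) (S : ℝ) (j : ℕ) (s : ℝ) : ℝ :=
  S * s / (t j * ‖coeff f (q j)‖ * q j)

/-- Away from the zeros of the shear, averages over small horizontal shifts at resonant times are
close to the space average. -/
theorem IsResonant.eventually_average (hr : IsResonant α f t q Q) (hα : Irrational α)
    (hfa : IsRealAnalytic f) (hpos : ∀ x, 0 < f x) (hint : ∫ x, f x = 1) (hφ : IsTest f φ)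
    (hψ : IsTest f ψ) {M : ℝ} (hM : 0 < M) (hfM : ∀ x, f x ≤ M) {δ ε : ℝ} (hδ : 0 < δ)
    (hε : 0 < ε) :
    ∃ S > 0, ∀ᶠ j in atTop, ∀ (x : UnitAddCircle),
      δ ≤ |((‖coeff f (q j)‖⁻¹ : ℂ) * coeff f (q j) * fourier (q j : ℤ) x).im| →
      ∀ r ∈ Set.Icc 0 M,
      ‖(∫ s in (0 : ℝ)..1, lift α f φ (x + shift f t q S j s) (r + t j)
          * ψ (x + shift f t q S j s, r)) - (∫ p, φ p ∂flowMeasure f) * ψ (x, r)‖ ≤ ε := by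
  have hf := hfa.continuous
  obtain ⟨m, M', hm, -, hmM'⟩ := exists_roof_bound hf hpos
  have hmM : ∀ x, m ≤ f x ∧ f x ≤ M := fun x => ⟨(hmM' x).1, hfM x⟩
  obtain ⟨K₁, hK₁0, hK₁⟩ := hφ.exists_bound hf hpos
  obtain ⟨K₂, hK₂0, hK₂⟩ := hψ.exists_bound hf hpos
  set c : ℂ := ∫ p, φ p ∂flowMeasure f with hc
  -- The final error is `(K₁ + K₂) ε₁` from freezing the slide plus `2 ε₁ K₂` from the time average.
  set ε₁ : ℝ := ε / (K₁ + 3 * K₂) with hε₁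
  have hε₁0 : 0 < ε₁ := by positivity
  obtain ⟨C, hC0, hC⟩ := hφ.norm_integral_lift_sub_le hα hf hpos hint hε₁0
  -- Chosen so that `n/t ≥ 1/(2M)` and `|b| ≥ δ` force `|w| ≥ C/ε₁ + 1`, long enough for the time
  -- average.
  set S : ℝ := (C / ε₁ + 1) / (4 * Real.pi * (1 / (2 * M)) * δ) with hS
  have hS0 : 0 < S := by positivity
  have hSL : S * (4 * Real.pi * (1 / (2 * M)) * δ) = C / ε₁ + 1 := by
    rw [hS]; field_simp
  set W : ℝ := 4 * Real.pi * S * (2 / m) with hW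
  have hW0 : 0 < W := by positivity
  -- The heights compared below lie in this range: `v` is in `[0, M]`, the shear moves it by at most
  -- `W`, and the error of the increment is at most `1`.
  obtain ⟨δ₁, hδ₁, hu₁⟩ := uniform_lift (α := α) hf hpos hφ (M + W + 1) hε₁0
  obtain ⟨δ₂, hδ₂, hu₂⟩ := hψ.uniform hf hpos hε₁0
  refine ⟨S, hS0, ?_⟩
  have hsmall : Tendsto (fun j => S * (t j * ‖coeff f (q j)‖)⁻¹) atTop (𝓝 0) := by
    simpa using (tendsto_inv_atTop_zero.comp hr.tendsto_amplitude).const_mul S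
  filter_upwards [hr.eventually_increment hfa hS0 (C := 2 / m) (by positivity)
      (ε := min 1 (δ₁ / 2)) (by positivity),
    hr.tendsto_time.eventually_ge_atTop (2 * M),
    hsmall.eventually_lt_const (show 0 < min δ₁ δ₂ by positivity)]
    with j hinc htj hsj x hx r hrM
  have ht0 := hr.t_pos j
  have hq0 : (0 : ℝ) < q j := by exact_mod_cast hr.freq_pos j
  have hq1 : (1 : ℝ) ≤ q j := by exact_mod_cast hr.freq_pos j
  have ha0 : 0 < ‖coeff f (q j)‖ := norm_pos_iff.mpr (hr.coeff_ne_zero j)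
  obtain ⟨n, hn, hnu, hnl, hv0, hvM⟩ := crossings_bounds (α := α) hf hpos hm hM hmM
    htj hrM x
  set v := r + t j - birkhoff α f n x with hv
  set y := x + (n : ℤ) • (α : UnitAddCircle) with hy
  set b : ℝ := ((‖coeff f (q j)‖⁻¹ : ℂ) * coeff f (q j) * fourier (q j : ℤ) x).im with hb
  have hbim : (coeff f (q j) * fourier (q j : ℤ) x).im = ‖coeff f (q j)‖ * b := by
    have : (‖coeff f (q j)‖⁻¹ : ℂ) * coeff f (q j) * fourier (q j : ℤ) x
        = ((‖coeff f (q j)‖⁻¹ : ℝ) : ℂ) * (coeff f (q j) * fourier (q j : ℤ) x) := by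
      push_cast; ring
    rw [hb, this, Complex.im_ofReal_mul]
    field_simp
  have hb1 : |b| ≤ 1 := by
    refine (Complex.abs_im_le_norm _).trans ?_
    rw [norm_mul, norm_mul, norm_fourier_apply, norm_inv, Complex.norm_real, norm_norm]
    field_simp
    exact le_rfl
  set w : ℝ := 4 * Real.pi * S * (n / t j) * b with hw
  have hntu : n / t j ≤ 2 / m := by rwa [div_le_iff₀ ht0]
  have hntl : 1 / (2 * M) ≤ n / t j := by rwa [le_div_iff₀ ht0]
  have hwW : |w| ≤ W := by
    rw [hw, hW, abs_mul, abs_of_nonneg (by positivity : 0 ≤ 4 * Real.pi * S * (n / t j))]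
    calc _ ≤ 4 * Real.pi * S * (2 / m) * 1 := by gcongr
      _ = _ := mul_one _
  have hwl : C / ε₁ + 1 ≤ |w| := by
    rw [← hSL, hw, abs_mul, abs_of_nonneg (by positivity : 0 ≤ 4 * Real.pi * S * (n / t j))]
    calc S * (4 * Real.pi * (1 / (2 * M)) * δ) = 4 * Real.pi * S * (1 / (2 * M)) * δ := by ring
      _ ≤ _ := by gcongr
  have hw0 : 0 < |w| := lt_of_lt_of_le (by positivity) hwl
  have hshift : ∀ s ∈ Set.Icc (0 : ℝ) 1,
      ‖lift α f φ (x + shift f t q S j s) (r + t j) - lift α f φ y (v + w * s)‖ ≤ ε₁ ∧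
      ‖ψ (x + shift f t q S j s, r) - ψ (x, r)‖ ≤ ε₁ := by
    intro s hs
    set h := shift f t q S j s with hh
    have hh0 : |h| ≤ S / (t j * ‖coeff f (q j)‖ * q j) := by
      rw [hh, shift, abs_div, abs_of_nonneg (mul_nonneg hS0.le hs.1),
        abs_of_pos (by positivity : 0 < t j * ‖coeff f (q j)‖ * q j)]
      gcongr
      exact mul_le_of_le_one_right hS0.le hs.2
    have hh1 : |h| < min δ₁ δ₂ := by
      refine lt_of_le_of_lt (hh0.trans ?_) hsj
      rw [div_eq_mul_inv]
      exact mul_le_mul_of_nonneg_left (inv_anti₀ (by positivity)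
        (le_mul_of_one_le_right (by positivity) hq1)) hS0.le
    have hhn : ‖(h : UnitAddCircle)‖ < min δ₁ δ₂ := (norm_coe_le_abs h).trans_lt hh1
    refine ⟨?_, ?_⟩
    · have hi := hinc n hnu x h hh0
      have e1 : 4 * Real.pi * q j * h * n * (coeff f (q j) * fourier (q j : ℤ) x).im = w * s := by
        rw [hbim, hh, shift, hw]; field_simp
      rw [e1] at hi
      obtain ⟨d, hd⟩ : ∃ d, d = birkhoff α f n (x + h) - birkhoff α f n x := ⟨_, rfl⟩
      rw [← hd] at hi
      -- Undoing the same `n` crossings for the slid point puts it over `y + h` at height `v - d`,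
      -- where `d` is close to `-w s`. Both points now have bounded height, so uniform continuity
      -- applies.
      have e2 : lift α f φ (x + h) (r + t j) = lift α f φ (y + h) (v - d) := by
        rw [← lift_add_zsmul α hf hpos φ n (x + h) (r + t j), hy, add_right_comm]
        congr 1
        rw [hv, hd]; ring
      have hws : |w * s| ≤ W := by
        rw [abs_mul, abs_of_nonneg hs.1]
        exact (mul_le_of_le_one_right (abs_nonneg w) hs.2).trans hwW
      have hd1 : |v - d - (v + w * s)| = |d + w * s| := by
        rw [← abs_neg]; congr 1; ring
      have hi1 := hi.trans (min_le_left _ _)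
      have hi2 := hi.trans (min_le_right _ _)
      rw [e2]
      refine (hu₁ _ _ _ _ ?_ ?_ ?_ ?_).le
      · rw [abs_le] at hi1 hws ⊢
        constructor <;> linarith [hi1.1, hi1.2, hws.1, hws.2]
      · rw [abs_le] at hws ⊢
        constructor <;> linarith [hws.1, hws.2]
      · rw [add_sub_cancel_left]; exact hhn.trans_le (min_le_left _ _)
      · rw [hd1]; linarith
    · refine (hu₂ _ _ _ ?_).le
      rw [add_sub_cancel_left]; exact hhn.trans_le (min_le_right _ _)
  have hlc := hφ.continuous_lift α hf hpos
  have hcs : Continuous fun s : ℝ => ((shift f t q S j s : ℝ) : UnitAddCircle) := by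
    refine (AddCircle.continuous_mk' 1).comp ?_
    unfold shift
    fun_prop
  have hc1 : Continuous fun s : ℝ => lift α f φ (x + shift f t q S j s) (r + t j) :=
    Continuous.comp (g := fun p : UnitAddCircle × ℝ => lift α f φ p.1 p.2)
      (f := fun s : ℝ => (x + shift f t q S j s, r + t j)) hlc (by fun_prop)
  have hc2 : Continuous fun s : ℝ => ψ (x + shift f t q S j s, r) :=
    hψ.continuous.comp (by fun_prop)
  have hc3 : Continuous fun s : ℝ => lift α f φ y (v + w * s) :=
    (hφ.continuous_lift_right α hf hpos y).comp (by fun_prop)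
  have hc12 : Continuous fun s : ℝ => lift α f φ (x + shift f t q S j s) (r + t j)
      * ψ (x + shift f t q S j s, r) := hc1.mul hc2
  have hc34 : Continuous fun s : ℝ => lift α f φ y (v + w * s) * ψ (x, r) :=
    hc3.mul continuous_const
  have hI : ‖(∫ s in (0 : ℝ)..1, lift α f φ (x + shift f t q S j s) (r + t j)
        * ψ (x + shift f t q S j s, r))
      - (∫ s in (0 : ℝ)..1, lift α f φ y (v + w * s)) * ψ (x, r)‖ ≤ (K₁ + K₂) * ε₁ := by
    rw [← intervalIntegral.integral_mul_const, ← intervalIntegral.integral_sub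
      (hc12.intervalIntegrable _ _) (hc34.intervalIntegrable _ _)]
    refine (intervalIntegral.norm_integral_le_of_norm_le_const (C := (K₁ + K₂) * ε₁)
      fun s hs => ?_).trans (by simp)
    rw [Set.uIoc_of_le zero_le_one] at hs
    obtain ⟨h1, h2⟩ := hshift s ⟨hs.1.le, hs.2⟩
    have e : lift α f φ (x + shift f t q S j s) (r + t j) * ψ (x + shift f t q S j s, r)
        - lift α f φ y (v + w * s) * ψ (x, r)
        = lift α f φ (x + shift f t q S j s) (r + t j)
            * (ψ (x + shift f t q S j s, r) - ψ (x, r))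
          + (lift α f φ (x + shift f t q S j s) (r + t j) - lift α f φ y (v + w * s))
            * ψ (x, r) := by ring
    rw [e]
    refine (norm_add_le _ _).trans ?_
    rw [norm_mul, norm_mul]
    calc _ ≤ K₁ * ε₁ + ε₁ * K₂ := by
          gcongr
          · exact hK₁ _
          · exact hK₂ _
      _ = _ := by ring
  have hJ : ‖(∫ s in (0 : ℝ)..1, lift α f φ y (v + w * s)) - c‖ ≤ 2 * ε₁ := by
    refine (norm_integral_comp_add_mul_sub_le (fun v L hL => hC y v L hL) v
      (abs_pos.mp hw0)).trans ?_
    have : C / |w| ≤ ε₁ := by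
      rw [div_le_iff₀ hw0]
      have := mul_le_mul_of_nonneg_left hwl hε₁0.le
      have e : ε₁ * (C / ε₁ + 1) = C + ε₁ := by field_simp
      linarith
    linarith
  have e : ∀ I J P : ℂ, I - c * P = (I - J * P) + (J - c) * P := fun I J P => by ring
  rw [e _ (∫ s in (0 : ℝ)..1, lift α f φ y (v + w * s))]
  refine (norm_add_le _ _).trans ?_
  rw [norm_mul]
  calc _ ≤ (K₁ + K₂) * ε₁ + 2 * ε₁ * K₂ := by
        gcongr
        exact hK₂ _
    _ = (K₁ + 3 * K₂) * ε₁ := by ring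
    _ = ε := by rw [hε₁]; field_simp

end correlation

section correlation

variable {α : ℝ} {f : UnitAddCircle → ℝ} {φ ψ : UnitAddCircle × ℝ → ℂ}
  {t : ℕ → ℝ} {q : ℕ → ℕ} {Q : ℕ → ℝ}

theorem IsTest.setIntegral_mul (hψ : IsTest f ψ) {M : ℝ} (hfM : ∀ x, f x ≤ M)
    (F : UnitAddCircle × ℝ → ℂ) (h : UnitAddCircle) :
    ∫ p in Set.univ ×ˢ Set.Icc 0 M, F p * ψ (p.1 + h, p.2) = ∫ p, F p * ψ (p.1 + h, p.2) := by
  refine setIntegral_eq_integral_of_forall_compl_eq_zero fun p hp => ?_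
  by_contra h0
  have := hψ.support _ (right_ne_zero_of_mul h0)
  exact hp ⟨Set.mem_univ _, this.1.le, this.2.le.trans (hfM _)⟩

theorem IsTest.integral_flowMeasure_mul (hψ : IsTest f ψ) (F : UnitAddCircle × ℝ → ℂ) :
    ∫ p, F p * ψ p ∂flowMeasure f = ∫ p, F p * ψ p := by
  refine setIntegral_eq_integral_of_forall_compl_eq_zero fun p hp => ?_
  by_contra h0
  have := hψ.support _ (right_ne_zero_of_mul h0)
  exact hp ⟨this.1.le, this.2⟩

/-- A correlation is not changed by averaging over horizontal shifts. -/
theorem IsTest.correlation_eq_average (hf : Continuous f) (hpos : ∀ x, 0 < f x) (hφ : IsTest f φ)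
    (hψ : IsTest f ψ) {M : ℝ} (hfM : ∀ x, f x ≤ M) (T : ℝ) {h : ℝ → UnitAddCircle}
    (hh : Continuous h) :
    ∫ p, φ (specialFlow α f T p) * ψ p ∂flowMeasure f
      = ∫ p in Set.univ ×ˢ Set.Icc 0 M, ∫ s in (0 : ℝ)..1,
          lift α f φ (p.1 + h s) (p.2 + T) * ψ (p.1 + h s, p.2) := by
  obtain ⟨K₁, hK₁0, hK₁⟩ := hφ.exists_bound hf hpos
  obtain ⟨K₂, hK₂0, hK₂⟩ := hψ.exists_bound hf hpos
  have hfin : IsFiniteMeasure ((volume : Measure (UnitAddCircle × ℝ)).restrict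
      (Set.univ ×ˢ Set.Icc 0 M)) :=
    ⟨by rw [Measure.restrict_apply_univ]
        exact (isCompact_univ.prod isCompact_Icc).measure_lt_top⟩
  have hinv : (volume : Measure (UnitAddCircle × ℝ)).IsAddRightInvariant :=
    inferInstanceAs ((volume : Measure UnitAddCircle).prod (volume : Measure ℝ)).IsAddRightInvariant
  have hfin' : IsFiniteMeasure ((volume : Measure ℝ).restrict (Set.uIoc 0 1)) :=
    ⟨by rw [Measure.restrict_apply_univ, Set.uIoc_of_le zero_le_one]; exact measure_Ioc_lt_top⟩
  have hshift : ∀ s : ℝ, ∫ p in Set.univ ×ˢ Set.Icc 0 M,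
      lift α f φ (p.1 + h s) (p.2 + T) * ψ (p.1 + h s, p.2)
      = ∫ p, φ (specialFlow α f T p) * ψ p ∂flowMeasure f := by
    intro s
    rw [hψ.setIntegral_mul hfM (fun p => lift α f φ (p.1 + h s) (p.2 + T)),
      hψ.integral_flowMeasure_mul]
    simp_rw [comp_specialFlow]
    -- Translation by `(h s, 0)` preserves Lebesgue measure on all of `𝕋 × ℝ`, which is why the lift
    -- is used instead of the flow space.
    rw [← integral_add_right_eq_self (μ := (volume : Measure (UnitAddCircle × ℝ)))
      (fun p : UnitAddCircle × ℝ => lift α f φ p.1 (p.2 + T) * ψ p) (h s, (0 : ℝ))]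
    have e : ∀ p : UnitAddCircle × ℝ, p + (h s, (0 : ℝ)) = (p.1 + h s, p.2) := fun p =>
      Prod.ext rfl (add_zero p.2)
    simp_rw [e]
  have hcont : Continuous fun z : ℝ × (UnitAddCircle × ℝ) =>
      lift α f φ (z.2.1 + h z.1) (z.2.2 + T) * ψ (z.2.1 + h z.1, z.2.2) := by
    have h1 : Continuous fun z : ℝ × (UnitAddCircle × ℝ) =>
        lift α f φ (z.2.1 + h z.1) (z.2.2 + T) :=
      Continuous.comp (g := fun p : UnitAddCircle × ℝ => lift α f φ p.1 p.2)
        (f := fun z : ℝ × (UnitAddCircle × ℝ) => (z.2.1 + h z.1, z.2.2 + T))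
        (hφ.continuous_lift α hf hpos) (by fun_prop)
    have h2 := hψ.continuous
    exact h1.mul (by fun_prop)
  rw [← intervalIntegral_integral_swap]
  · simp_rw [hshift]
    simp
  · refine Integrable.of_bound (C := K₁ * K₂) hcont.aestronglyMeasurable
      (Eventually.of_forall fun z => ?_)
    simp only [Function.uncurry]
    rw [norm_mul]
    gcongr
    · exact hK₁ _
    · exact hK₂ _

theorem IsResonant.tendsto_correlation (hr : IsResonant α f t q Q) (hα : Irrational α)
    (hfa : IsRealAnalytic f) (hpos : ∀ x, 0 < f x) (hint : ∫ x, f x = 1) (hφ : IsTest f φ)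
    (hψ : IsTest f ψ) :
    Tendsto (fun j => ∫ p, φ (specialFlow α f (t j) p) * ψ p ∂flowMeasure f) atTop
      (𝓝 ((∫ p, φ p ∂flowMeasure f) * ∫ p, ψ p ∂flowMeasure f)) := by
  have hf := hfa.continuous
  obtain ⟨m, M, -, hM, hmM⟩ := exists_roof_bound hf hpos
  have hfM : ∀ x, f x ≤ M := fun x => (hmM x).2
  obtain ⟨K₁, hK₁0, hK₁⟩ := hφ.exists_bound hf hpos
  obtain ⟨K₂, hK₂0, hK₂⟩ := hψ.exists_bound hf hpos
  set c : ℂ := ∫ p, φ p ∂flowMeasure f with hc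
  set R : Set (UnitAddCircle × ℝ) := Set.univ ×ˢ Set.Icc 0 M with hR
  have hRm : MeasurableSet R := MeasurableSet.univ.prod measurableSet_Icc
  have hfin : IsFiniteMeasure ((volume : Measure (UnitAddCircle × ℝ)).restrict R) :=
    ⟨by rw [Measure.restrict_apply_univ]
        exact (isCompact_univ.prod isCompact_Icc).measure_lt_top⟩
  rw [Metric.tendsto_atTop']
  intro ε hε
  set D : ℝ := K₁ * K₂ + ‖c‖ * K₂ with hD
  have hD0 : 0 < D := by positivity
  -- The integrand is at most `D` on the exceptional strip and at most `ε/(4M)` off it. Over height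
  -- `M` each part contributes at most `ε/4`.
  obtain ⟨δ, hδ, hvol⟩ := exists_volume_im_fourier_lt (ε := ε / (4 * M * D)) (by positivity)
  obtain ⟨S, hS, hev⟩ := hr.eventually_average hα hfa hpos hint hφ hψ hM hfM hδ
    (ε := ε / (4 * M)) (by positivity)
  obtain ⟨N, hN⟩ := eventually_atTop.mp hev
  refine ⟨N, fun j hj => ?_⟩
  have havg := hN j hj.le
  have hcs : Continuous fun s : ℝ => ((shift f t q S j s : ℝ) : UnitAddCircle) := by
    refine (AddCircle.continuous_mk' 1).comp ?_
    unfold shift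
    fun_prop
  have ha0 : 0 < ‖coeff f (q j)‖ := norm_pos_iff.mpr (hr.coeff_ne_zero j)
  set B : Set UnitAddCircle :=
    {x | |((‖coeff f (q j)‖⁻¹ : ℂ) * coeff f (q j) * fourier (q j : ℤ) x).im| < δ} with hB
  have hBm : MeasurableSet B :=
    measurableSet_lt (Continuous.measurable (by fun_prop)) measurable_const
  have hBvol : volume.real B ≤ ε / (4 * M * D) := by
    rw [hB, volume_im_mul_fourier_lt ?_ (hr.freq_pos j)]
    · exact hvol
    · rw [norm_mul, norm_inv, Complex.norm_real, norm_norm, inv_mul_cancel₀ ha0.ne']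
  have hψR : ∫ p, ψ p ∂flowMeasure f = ∫ p in R, ψ p := by
    have h1 := hψ.integral_flowMeasure_mul (fun _ => 1)
    have h2 := hψ.setIntegral_mul hfM (fun _ => 1) 0
    simp only [one_mul, add_zero] at h1 h2
    rw [h1, h2]
  rw [dist_eq_norm, hφ.correlation_eq_average hf hpos hψ hfM (t j) hcs, hψR,
    ← integral_const_mul]
  set J : UnitAddCircle × ℝ → ℂ := fun p => ∫ s in (0 : ℝ)..1,
    lift α f φ (p.1 + shift f t q S j s) (p.2 + t j) * ψ (p.1 + shift f t q S j s, p.2) with hJ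
  have hJbound : ∀ p, ‖J p‖ ≤ K₁ * K₂ := by
    intro p
    refine (intervalIntegral.norm_integral_le_of_norm_le_const (C := K₁ * K₂)
      fun s _ => ?_).trans (by simp)
    rw [norm_mul]
    gcongr
    · exact hK₁ _
    · exact hK₂ _
  have hJcont : Continuous J := by
    have h1 : Continuous fun z : (UnitAddCircle × ℝ) × ℝ =>
        lift α f φ (z.1.1 + shift f t q S j z.2) (z.1.2 + t j) :=
      Continuous.comp (g := fun p : UnitAddCircle × ℝ => lift α f φ p.1 p.2)
        (f := fun z : (UnitAddCircle × ℝ) × ℝ => (z.1.1 + shift f t q S j z.2, z.1.2 + t j))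
        (hφ.continuous_lift α hf hpos) ((continuous_fst.fst.add (hcs.comp continuous_snd)).prodMk
          (continuous_fst.snd.add continuous_const))
    have h2 : Continuous fun z : (UnitAddCircle × ℝ) × ℝ =>
        ψ (z.1.1 + shift f t q S j z.2, z.1.2) :=
      hψ.continuous.comp ((continuous_fst.fst.add (hcs.comp continuous_snd)).prodMk
        continuous_fst.snd)
    exact intervalIntegral.continuous_parametric_intervalIntegral_of_continuous'
      (h1.mul h2) 0 1
  rw [← integral_sub (Integrable.of_bound (C := K₁ * K₂) hJcont.aestronglyMeasurable
      (Eventually.of_forall hJbound))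
    ((Integrable.of_bound (C := K₂) hψ.continuous.aestronglyMeasurable
      (Eventually.of_forall hK₂)).const_mul c)]
  have hg : Integrable (fun p : UnitAddCircle × ℝ => ε / (4 * M)
      + (B ×ˢ (Set.univ : Set ℝ)).indicator (fun _ => D) p) (volume.restrict R) :=
    (integrable_const _).add ((integrable_const D).indicator (hBm.prod MeasurableSet.univ))
  refine lt_of_le_of_lt (norm_integral_le_of_norm_le hg ?_) ?_
  · refine (ae_restrict_iff' hRm).mpr (Eventually.of_forall fun p hp => ?_)
    by_cases hpB : p.1 ∈ B
    · rw [Set.indicator_of_mem (show p ∈ B ×ˢ (Set.univ : Set ℝ) from ⟨hpB, Set.mem_univ _⟩)]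
      refine (norm_sub_le _ _).trans (le_trans ?_ (le_add_of_nonneg_left (by positivity)))
      rw [norm_mul, hD]
      gcongr
      · exact hJbound p
      · exact hK₂ p
    · rw [Set.indicator_of_notMem (fun h => hpB h.1), add_zero]
      exact havg p.1 (not_lt.mp hpB) p.2 hp.2
  · rw [integral_add (integrable_const _)
      ((integrable_const D).indicator (hBm.prod MeasurableSet.univ)), integral_const,
      integral_indicator_const _ (hBm.prod MeasurableSet.univ)]
    have h1 : (volume.restrict R).real (Set.univ : Set (UnitAddCircle × ℝ)) = M := by
      rw [measureReal_restrict_apply MeasurableSet.univ, Set.univ_inter, hR,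
        Measure.volume_eq_prod, measureReal_prod_prod]
      simp [measureReal_def, hM.le]
    have h2 : (volume.restrict R).real (B ×ˢ (Set.univ : Set ℝ)) = volume.real B * M := by
      rw [measureReal_restrict_apply (hBm.prod MeasurableSet.univ), hR, Set.prod_inter_prod,
        Set.inter_univ, Set.univ_inter, Measure.volume_eq_prod, measureReal_prod_prod]
      congr 1
      simp [measureReal_def, hM.le]
    rw [h1, h2, smul_eq_mul, smul_eq_mul]
    have h3 : volume.real B * M * D ≤ ε / (4 * M * D) * M * D := by gcongr
    have h4 : ε / (4 * M * D) * M * D = ε / 4 := by field_simp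
    have h5 : M * (ε / (4 * M)) = ε / 4 := by field_simp
    linarith

end correlation

/-! ### Density of test functions -/

theorem ae_snd_ne_zero : ∀ᵐ p : UnitAddCircle × ℝ, p.2 ≠ 0 := by
  have h0 : volume {p : UnitAddCircle × ℝ | p.2 = 0} = 0 := by
    have : {p : UnitAddCircle × ℝ | p.2 = 0} = Set.univ ×ˢ {0} := by ext p; simp
    rw [this, Measure.volume_eq_prod, Measure.prod_prod]; simp
  rw [ae_iff]
  simpa using h0

theorem isProbabilityMeasure_flowMeasure {f : UnitAddCircle → ℝ} (hf : Continuous f)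
    (hpos : ∀ x, 0 < f x) (hint : ∫ x, f x = 1) : IsProbabilityMeasure (flowMeasure f) := by
  refine ⟨?_⟩
  have hset : flowSpace f =ᵐ[volume] regionBetween (fun _ => 0) f Set.univ := by
    filter_upwards [ae_snd_ne_zero] with p hp
    refine propext ⟨fun h => ?_, fun h => ?_⟩
    · exact ⟨Set.mem_univ _, lt_of_le_of_ne h.1 (Ne.symm hp), h.2⟩
    · exact ⟨h.2.1.le, h.2.2⟩
  rw [flowMeasure, Measure.restrict_apply_univ, measure_congr hset, Measure.volume_eq_prod,
    volume_regionBetween_eq_integral (by simp)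
    ((hf.integrable_of_hasCompactSupport (HasCompactSupport.of_compactSpace _)).integrableOn)
    MeasurableSet.univ fun x _ => (hpos x).le]
  simp [hint]

theorem ae_flowMeasure {f : UnitAddCircle → ℝ} (hf : Continuous f) :
    ∀ᵐ p ∂flowMeasure f, 0 < p.2 ∧ p.2 < f p.1 := by
  refine (ae_restrict_iff' (measurableSet_flowSpace hf)).mpr ?_
  filter_upwards [ae_snd_ne_zero] with p hp h
  exact ⟨lt_of_le_of_ne h.1 (Ne.symm hp), h.2⟩

/-- Continuous cutoff functions exhausting the open region below the roof. -/
def cutoff (f : UnitAddCircle → ℝ) (k : ℕ) (p : UnitAddCircle × ℝ) : ℝ :=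
  min 1 (max 0 (k * min p.2 (f p.1 - p.2)))

theorem cutoff_mem_Icc (f : UnitAddCircle → ℝ) (k : ℕ) (p : UnitAddCircle × ℝ) :
    cutoff f k p ∈ Set.Icc 0 1 :=
  ⟨le_min zero_le_one (le_max_left _ _), min_le_left _ _⟩

theorem isTest_cutoff_smul {f : UnitAddCircle → ℝ} (hf : Continuous f)
    {g : UnitAddCircle × ℝ → ℂ} (hg : Continuous g) (k : ℕ) :
    IsTest f fun p => (cutoff f k p : ℂ) * g p where
  continuous := by
    unfold cutoff
    fun_prop
  support p hp := by
    have h : cutoff f k p ≠ 0 := by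
      intro h
      simp [h] at hp
    by_contra hn
    refine h ?_
    have : min p.2 (f p.1 - p.2) ≤ 0 := by
      rw [min_le_iff]
      by_contra h'
      exact hn ⟨by linarith [not_or.mp h'], by linarith [not_or.mp h']⟩
    rw [cutoff, max_eq_left (mul_nonpos_of_nonneg_of_nonpos (Nat.cast_nonneg k) this)]
    exact min_eq_right zero_le_one

theorem tendsto_cutoff {f : UnitAddCircle → ℝ} {p : UnitAddCircle × ℝ}
    (hp : 0 < p.2 ∧ p.2 < f p.1) : Tendsto (fun k => cutoff f k p) atTop (𝓝 1) := by
  have hm : 0 < min p.2 (f p.1 - p.2) := lt_min hp.1 (by linarith)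
  refine tendsto_const_nhds.congr' ?_
  filter_upwards [(tendsto_natCast_atTop_atTop (R := ℝ)).eventually_ge_atTop
    (min p.2 (f p.1 - p.2))⁻¹] with k hk
  have : 1 ≤ k * min p.2 (f p.1 - p.2) := by
    rwa [inv_le_iff_one_le_mul₀ hm] at hk
  rw [cutoff, max_eq_right (by linarith), min_eq_left this]

theorem IsTest.memLp {f : UnitAddCircle → ℝ} {φ : UnitAddCircle × ℝ → ℂ} (hf : Continuous f)
    (hpos : ∀ x, 0 < f x) [IsFiniteMeasure (flowMeasure f)] (hφ : IsTest f φ) :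
    MemLp φ 2 (flowMeasure f) := by
  obtain ⟨K, -, hK⟩ := hφ.exists_bound hf hpos
  exact MemLp.of_bound hφ.continuous.aestronglyMeasurable K (Eventually.of_forall hK)

/-- Bounded continuous functions are dense in `L²`; multiplied by the cutoffs they become test
functions, and dominated convergence applies since almost every point lies in the open region. -/
theorem exists_isTest_eLpNorm_sub_le {f : UnitAddCircle → ℝ} (hf : Continuous f)
    [IsFiniteMeasure (flowMeasure f)]
    {g : UnitAddCircle × ℝ → ℂ} (hg : MemLp g 2 (flowMeasure f)) {ε : ℝ} (hε : 0 < ε) :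
    ∃ φ, IsTest f φ ∧ eLpNorm (g - φ) 2 (flowMeasure f) ≤ ENNReal.ofReal ε := by
  obtain ⟨g₀, hg₀, hg₀m⟩ := hg.exists_boundedContinuous_eLpNorm_sub_le (by norm_num)
    (ε := ENNReal.ofReal (ε / 2)) (by simpa using hε)
  have hlim : Tendsto (fun k : ℕ => ∫⁻ p, ‖g₀ p - (cutoff f k p : ℂ) * g₀ p‖ₑ ^ (2 : ℝ)
      ∂flowMeasure f) atTop (𝓝 (∫⁻ _, 0 ∂flowMeasure f)) := by
    refine tendsto_lintegral_of_dominated_convergence (fun p => ‖g₀ p‖ₑ ^ (2 : ℝ)) ?_ ?_ ?_ ?_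
    · intro k
      have := (isTest_cutoff_smul hf g₀.continuous k).continuous
      exact ((g₀.continuous.sub this).measurable.enorm).pow_const _
    · intro k
      refine Eventually.of_forall fun p => ?_
      simp only
      gcongr
      rw [enorm_le_iff_norm_le]
      have h1 := cutoff_mem_Icc f k p
      have e : g₀ p - (cutoff f k p : ℂ) * g₀ p = ((1 - cutoff f k p : ℝ) : ℂ) * g₀ p := by
        push_cast; ring
      rw [e, norm_mul, Complex.norm_real, Real.norm_eq_abs, abs_of_nonneg (by linarith [h1.2])]
      exact mul_le_of_le_one_left (norm_nonneg _) (by linarith [h1.1])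
    · have := lintegral_rpow_enorm_lt_top_of_eLpNorm_lt_top (p := 2) (by norm_num) (by norm_num)
        hg₀m.eLpNorm_lt_top
      simpa using this.ne
    · filter_upwards [ae_flowMeasure hf] with p hp
      have h1 : Tendsto (fun k => g₀ p - (cutoff f k p : ℂ) * g₀ p) atTop (𝓝 0) := by
        have h2 : Tendsto (fun k => (cutoff f k p : ℂ)) atTop (𝓝 1) := by
          have := (Complex.continuous_ofReal.tendsto 1).comp (tendsto_cutoff hp)
          simpa [Function.comp_def] using this
        simpa using (tendsto_const_nhds (x := g₀ p)).sub (h2.mul_const (g₀ p))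
      have h3 := (ENNReal.continuous_rpow_const (y := 2)).tendsto _ |>.comp h1.enorm
      simpa [Function.comp_def] using h3
  rw [lintegral_zero] at hlim
  have hlim2 : Tendsto (fun k : ℕ => eLpNorm (⇑g₀ - fun p => (cutoff f k p : ℂ) * g₀ p) 2
      (flowMeasure f)) atTop (𝓝 0) := by
    have h := (ENNReal.continuous_rpow_const (y := 1 / 2)).tendsto _ |>.comp hlim
    rw [ENNReal.zero_rpow_of_pos (by norm_num)] at h
    refine h.congr fun k => ?_
    rw [eLpNorm_eq_lintegral_rpow_enorm_toReal (by norm_num) (by norm_num)]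
    simp
  obtain ⟨k, hk⟩ := ((ENNReal.tendsto_nhds_zero.mp hlim2) (ENNReal.ofReal (ε / 2))
    (by simpa using hε)).exists
  have ht := isTest_cutoff_smul hf g₀.continuous k
  refine ⟨_, ht, ?_⟩
  have e : (g - fun p => (cutoff f k p : ℂ) * g₀ p)
      = (g - ⇑g₀) + (⇑g₀ - fun p => (cutoff f k p : ℂ) * g₀ p) := by abel
  rw [e]
  refine (eLpNorm_add_le (hg.aestronglyMeasurable.sub hg₀m.aestronglyMeasurable)
    (hg₀m.aestronglyMeasurable.sub ht.continuous.aestronglyMeasurable) (by norm_num)).trans ?_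
  refine (add_le_add hg₀ hk).trans (le_of_eq ?_)
  rw [← ENNReal.ofReal_add (by positivity) (by positivity), add_halves]

/-! ### Mixing from a dense set -/

/-- Convergence of the correlations of a sequence of isometries to those of the projection onto a
vector extends from a dense set to the whole space. -/
theorem tendsto_inner_of_dense {H : Type*} [NormedAddCommGroup H] [InnerProductSpace ℂ H]
    (U : ℕ → H →ₗᵢ[ℂ] H) (e : H) {D : Set H} (hD : Dense D)
    (h : ∀ x ∈ D, ∀ y ∈ D, Tendsto (fun n => inner ℂ y (U n x)) atTop
      (𝓝 (inner ℂ e x * inner ℂ y e))) (x y : H) :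
    Tendsto (fun n => inner ℂ y (U n x)) atTop (𝓝 (inner ℂ e x * inner ℂ y e)) := by
  have hbound : ∀ n x y, ‖inner ℂ y (U n x) - inner ℂ e x * inner ℂ y e‖
      ≤ (1 + ‖e‖ ^ 2) * (‖x‖ * ‖y‖) := by
    intro n x y
    refine (norm_sub_le _ _).trans ?_
    have h1 : ‖inner ℂ y (U n x)‖ ≤ ‖y‖ * ‖x‖ := by
      simpa using norm_inner_le_norm (𝕜 := ℂ) y (U n x)
    have h2 : ‖inner ℂ e x * inner ℂ y e‖ ≤ (‖e‖ * ‖x‖) * (‖y‖ * ‖e‖) := by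
      rw [norm_mul]
      exact mul_le_mul (norm_inner_le_norm _ _) (norm_inner_le_norm _ _) (norm_nonneg _)
        (by positivity)
    calc _ ≤ ‖y‖ * ‖x‖ + (‖e‖ * ‖x‖) * (‖y‖ * ‖e‖) := add_le_add h1 h2
      _ = _ := by ring
  rw [Metric.tendsto_atTop']
  intro ε hε
  set A : ℝ := 1 + ‖e‖ ^ 2 with hA
  have hA0 : 0 < A := by positivity
  obtain ⟨x', hx', hxx'⟩ := hD.exists_dist_lt x (ε := ε / (3 * A * (‖y‖ + 1))) (by positivity)
  -- `y'` is chosen after `x'`, since the telescoping below pairs `y - y'` with `x'`.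
  obtain ⟨y', hy', hyy'⟩ := hD.exists_dist_lt y (ε := ε / (3 * A * (‖x'‖ + 1))) (by positivity)
  rw [dist_eq_norm] at hxx' hyy'
  obtain ⟨N, hN⟩ := Metric.tendsto_atTop'.mp (h x' hx' y' hy') (ε / 3) (by positivity)
  refine ⟨N, fun n hn => ?_⟩
  have h3 := hN n hn
  rw [dist_eq_norm] at h3 ⊢
  have h1 := hbound n (x - x') y
  have h2 := hbound n x' (y - y')
  have e1 : inner ℂ y (U n x) - inner ℂ e x * inner ℂ y e
      = (inner ℂ y (U n (x - x')) - inner ℂ e (x - x') * inner ℂ y e)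
        + (inner ℂ (y - y') (U n x') - inner ℂ e x' * inner ℂ (y - y') e)
        + (inner ℂ y' (U n x') - inner ℂ e x' * inner ℂ y' e) := by
    simp only [map_sub, inner_sub_left, inner_sub_right]; ring
  have b1 : A * (‖x - x'‖ * ‖y‖) ≤ ε / 3 := by
    calc A * (‖x - x'‖ * ‖y‖) ≤ A * (ε / (3 * A * (‖y‖ + 1)) * (‖y‖ + 1)) := by
          gcongr
          linarith
      _ = ε / 3 := by field_simp
  have b2 : A * (‖x'‖ * ‖y - y'‖) ≤ ε / 3 := by
    calc A * (‖x'‖ * ‖y - y'‖) ≤ A * ((‖x'‖ + 1) * (ε / (3 * A * (‖x'‖ + 1)))) := by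
          gcongr
          linarith
      _ = ε / 3 := by field_simp
  rw [e1]
  refine lt_of_le_of_lt (norm_add₃_le) ?_
  linarith

theorem inner_toLp_eq {X : Type*} [MeasurableSpace X] {μ : Measure X} {g₁ g₂ : X → ℂ}
    (h₁ : MemLp g₁ 2 μ) (h₂ : MemLp g₂ 2 μ) :
    inner ℂ (h₂.toLp g₂) (h₁.toLp g₁) = ∫ x, g₁ x * (starRingEnd ℂ) (g₂ x) ∂μ := by
  rw [L2.inner_def]
  refine integral_congr_ae ?_
  filter_upwards [h₁.coeFn_toLp, h₂.coeFn_toLp] with x hx₁ hx₂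
  rw [hx₁, hx₂, RCLike.inner_apply]

theorem tendsto_correlation_of_isTest {α : ℝ} {f : UnitAddCircle → ℝ} (hf : Continuous f)
    (hpos : ∀ x, 0 < f x) (hint : ∫ x, f x = 1) {t : ℕ → ℝ}
    (h : ∀ φ ψ, IsTest f φ → IsTest f ψ →
      Tendsto (fun j => ∫ p, φ (specialFlow α f (t j) p) * ψ p ∂flowMeasure f) atTop
        (𝓝 ((∫ p, φ p ∂flowMeasure f) * ∫ p, ψ p ∂flowMeasure f)))
    {g₁ g₂ : UnitAddCircle × ℝ → ℂ} (hg₁ : MemLp g₁ 2 (flowMeasure f))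
    (hg₂ : MemLp g₂ 2 (flowMeasure f)) :
    Tendsto (fun n => ∫ x, g₁ (specialFlow α f (t n) x) * (starRingEnd ℂ) (g₂ x) ∂flowMeasure f)
      atTop (𝓝 ((∫ x, g₁ x ∂flowMeasure f) * ∫ x, (starRingEnd ℂ) (g₂ x) ∂flowMeasure f)) := by
  have hprob := isProbabilityMeasure_flowMeasure hf hpos hint
  have hmp := fun n => measurePreserving_specialFlow α hf hpos (t n)
  have hone : MemLp (fun _ => (1 : ℂ)) 2 (flowMeasure f) := memLp_const 1
  -- The isometries are the Koopman operators of the times `t n`, and the distinguished vector is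
  -- the constant `1`.
  have key := tendsto_inner_of_dense (H := Lp ℂ 2 (flowMeasure f))
    (fun n => Lp.compMeasurePreservingₗᵢ ℂ (specialFlow α f (t n)) (hmp n)) (hone.toLp _)
    (D := {G | ∃ (φ : UnitAddCircle × ℝ → ℂ) (hφ : IsTest f φ), G = (hφ.memLp hf hpos).toLp φ})
    ?_ ?_ (hg₁.toLp g₁) (hg₂.toLp g₂)
  · have e : ∀ n, inner ℂ (hg₂.toLp g₂)
        (Lp.compMeasurePreservingₗᵢ ℂ (specialFlow α f (t n)) (hmp n) (hg₁.toLp g₁))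
        = ∫ x, g₁ (specialFlow α f (t n) x) * (starRingEnd ℂ) (g₂ x) ∂flowMeasure f := fun n =>
      inner_toLp_eq (hg₁.comp_measurePreserving (hmp n)) hg₂
    simp only [e, inner_toLp_eq, map_one, mul_one, one_mul] at key
    exact key
  · refine Metric.dense_iff.mpr fun G ε hε => ?_
    obtain ⟨φ, hφ, hle⟩ := exists_isTest_eLpNorm_sub_le hf (Lp.memLp G) (half_pos hε)
    refine ⟨_, ?_, φ, hφ, rfl⟩
    rw [Metric.mem_ball, dist_comm, dist_eq_norm]
    have : G - (hφ.memLp hf hpos).toLp φ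
        = ((Lp.memLp G).sub (hφ.memLp hf hpos)).toLp (⇑G - φ) := by
      rw [MemLp.toLp_sub (Lp.memLp G), Lp.toLp_coeFn]
    rw [this, Lp.norm_toLp]
    exact lt_of_le_of_lt (ENNReal.toReal_le_of_le_ofReal (half_pos hε).le hle) (half_lt_self hε)
  · rintro _ ⟨φ, hφ, rfl⟩ _ ⟨ψ, hψ, rfl⟩
    have hψc : IsTest f fun p => (starRingEnd ℂ) (ψ p) :=
      ⟨Complex.continuous_conj.comp hψ.continuous, fun p hp =>
        hψ.support p fun h0 => hp (by simp [h0])⟩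
    have e : ∀ n, inner ℂ ((hψ.memLp hf hpos).toLp ψ)
        (Lp.compMeasurePreservingₗᵢ ℂ (specialFlow α f (t n)) (hmp n) ((hφ.memLp hf hpos).toLp φ))
        = ∫ x, φ (specialFlow α f (t n) x) * (starRingEnd ℂ) (ψ x) ∂flowMeasure f := fun n =>
      inner_toLp_eq ((hφ.memLp hf hpos).comp_measurePreserving (hmp n)) (hψ.memLp hf hpos)
    simp only [e, inner_toLp_eq, map_one, mul_one, one_mul]
    exact h φ _ hφ hψc

/-! ### The rotation numbers in `U` -/

theorem two_mul_sq_div_lt_convDen_eta {β : ℝ} (hβ : Irrational β) (f : UnitAddCircle → ℝ)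
    (l : ℕ → ℕ) (k : ℕ) :
    2 * (k : ℝ) ^ 2 / ‖coeff f (l k)‖ ^ 2 < convDen β (eta β f l k) := by
  have hne : {n : ℕ | 1 ≤ n ∧ 2 * (k : ℝ) ^ 2 / ‖coeff f (l k)‖ ^ 2 < convDen β n}.Nonempty :=
    ((eventually_ge_atTop 1).and ((tendsto_convDen hβ).eventually_gt_atTop _)).exists
  exact (Nat.sInf_mem hne).2

/-- The choice of `η` gives `t a² > 2k²`, hence `t a → ∞` as `a ≤ 1`. Membership in `V` at index `i`
gives `Q > 2 t i²`, hence `t/Q ≤ 1/i`. -/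
theorem exists_isResonant {β : ℝ} (hβ : Irrational β) {f : UnitAddCircle → ℝ}
    (hpos : ∀ x, 0 < f x) (hint : ∫ x, f x = 1) {l : ℕ → ℕ} (hl : IsDominantSequence f l) {α : ℝ}
    (hα : Irrational α) {k : ℕ → ℕ} (hk : StrictMono k)
    (hkU : ∀ n, 1 ≤ k n ∧ α ∈ setUj β f l (k n)) :
    ∃ Q, IsResonant α f (fun n => convDen β (eta β f l (k n))) (fun n => l (k n)) Q := by
  have hV : ∀ n, ∃ i : ℕ, 1 ≤ i ∧ α ∈ setV β f l i (k n) := fun n => by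
    simpa [setUj] using (hkU n).2
  choose i hi1 hiV using hV
  set t : ℕ → ℝ := fun n => convDen β (eta β f l (k n)) with ht
  have ha0 : ∀ n, 0 < ‖coeff f (l (k n))‖ := fun n =>
    norm_pos_iff.mpr (hl.coeff_ne_zero _ (hkU n).1)
  have ha1 : ∀ n, ‖coeff f (l (k n))‖ ≤ 1 := fun n =>
    (norm_coeff_le_integral hpos _).trans hint.le
  have hkn : ∀ n : ℕ, (n : ℝ) ≤ 2 * (k n : ℝ) ^ 2 := fun n => by
    have h1 : (n : ℝ) ≤ k n := by exact_mod_cast hk.id_le n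
    have h2 : (1 : ℝ) ≤ k n := by exact_mod_cast (hkU n).1
    nlinarith
  have hta : ∀ n, 2 * (k n : ℝ) ^ 2 < t n * ‖coeff f (l (k n))‖ ^ 2 := fun n => by
    have := two_mul_sq_div_lt_convDen_eta hβ f l (k n)
    rwa [div_lt_iff₀ (pow_pos (ha0 n) 2)] at this
  have ht0 : ∀ n, 0 < t n := fun n =>
    lt_of_le_of_lt (by positivity) (two_mul_sq_div_lt_convDen_eta hβ f l (k n))
  have hamp : ∀ n : ℕ, (n : ℝ) ≤ t n * ‖coeff f (l (k n))‖ := fun n => by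
    have h1 : t n * ‖coeff f (l (k n))‖ ^ 2 ≤ t n * ‖coeff f (l (k n))‖ := by
      have := ht0 n
      gcongr
      exact pow_le_of_le_one (norm_nonneg _) (ha1 n) two_ne_zero
    linarith [hkn n, hta n]
  have htime : ∀ n : ℕ, (n : ℝ) ≤ t n := fun n =>
    (hamp n).trans (mul_le_of_le_one_right (ht0 n).le (ha1 n))
  have hiQ : ∀ n, 2 * t n * (i n : ℝ) ^ 2 < convDen α (i n + 1) := fun n => (hiV n).2.2
  have hi0 : ∀ n, (0 : ℝ) < i n := fun n => by exact_mod_cast hi1 n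
  have hQ0 : ∀ n, 0 < convDen α (i n + 1) := fun n =>
    lt_trans (by have := ht0 n; have := hi0 n; positivity) (hiQ n)
  have hlk : StrictMono fun n => l (k n) := fun a b hab =>
    hl.strictMonoOn (hkU a).1 (hkU b).1 (hk hab)
  -- Denominators of `α` of bounded index are bounded, whereas `q_i(α) = l (k n)` tends to infinity.
  have hitop : Tendsto i atTop atTop := by
    refine tendsto_atTop.mpr fun N => ?_
    have hlt : Tendsto (fun n => (l (k n) : ℝ)) atTop atTop :=
      tendsto_natCast_atTop_atTop.comp hlk.tendsto_atTop
    filter_upwards [hlt.eventually_gt_atTop (convDen α N)] with n hn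
    by_contra h
    have h1 := convDen_monotone α (not_le.mp h).le
    rw [(hiV n).2.1] at h1
    linarith
  refine ⟨fun n => convDen α (i n + 1), fun n => hl.pos _ (hkU n).1, hQ0, ht0, fun n =>
    exists_isCoprime_abs_sub_le hα (hiV n).2.1, fun n => hl.coeff_ne_zero _ (hkU n).1,
    tendsto_atTop_mono htime tendsto_natCast_atTop_atTop, hl.tendsto_zero.comp hk.tendsto_atTop,
    tendsto_atTop_mono hamp tendsto_natCast_atTop_atTop, ?_⟩
  have hinv : Tendsto (fun n => ((i n : ℝ))⁻¹) atTop (𝓝 0) :=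
    tendsto_inv_atTop_zero.comp (tendsto_natCast_atTop_atTop.comp hitop)
  refine squeeze_zero (fun n => (div_pos (ht0 n) (hQ0 n)).le) (fun n => ?_) hinv
  rw [div_le_iff₀ (hQ0 n), ← div_eq_inv_mul, le_div_iff₀ (hi0 n)]
  have h1 : (1 : ℝ) ≤ i n := by exact_mod_cast hi1 n
  have h2 : t n * i n ≤ t n * (i n : ℝ) ^ 2 := by
    have := ht0 n
    gcongr
    exact le_self_pow₀ h1 two_ne_zero
  have h3 : 0 ≤ t n * (i n : ℝ) ^ 2 := by have := ht0 n; positivity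
  linarith [hiQ n]

end SpecialFlowMixing

end

open SpecialFlowMixing in
theorem mainTheorem5 (β : ℝ) (hβ : Irrational β)
    (f : UnitAddCircle → ℝ) (hf : IsRealAnalytic f) (hf_trig : ¬ IsTrigPolynomial f)
    (hf_pos : ∀ x, 0 < f x) (hf_int : ∫ x : UnitAddCircle, f x = 1)
    (l : ℕ → ℕ) (hl : IsDominantSequence f l)
    (α : ℝ) (hα : α ∈ setU β f l) :
    (∃ k : ℕ → ℕ, StrictMono k ∧ ∀ n, 1 ≤ k n ∧ α ∈ setUj β f l (k n)) ∧
    ∀ k : ℕ → ℕ, StrictMono k → (∀ n, 1 ≤ k n ∧ α ∈ setUj β f l (k n)) →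
      IsMixingAlong (specialFlow α f) (flowMeasure f)
        (fun n => convDen β (eta β f l (k n))) := by
  have hfreq : ∃ᶠ j in atTop, 1 ≤ j ∧ α ∈ setUj β f l j := by
    refine frequently_atTop.mpr fun M => ?_
    -- The maximum with `1` keeps the index positive, as the intersection starts at `1` and `l 0` is
    -- unconstrained.
    have h := Set.mem_iInter₂.mp hα (max M 1) (le_max_right _ _)
    obtain ⟨j, hj, hαj⟩ := Set.mem_iUnion₂.mp h
    exact ⟨j, (le_max_left _ _).trans hj, (le_max_right _ _).trans hj, hαj⟩
  refine ⟨extraction_of_frequently_atTop hfreq, fun k hk hkU => ?_⟩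
  have hα' : Irrational α := by
    obtain ⟨n, -, hn⟩ := Set.mem_iUnion₂.mp (hkU 0).2
    exact hn.1
  obtain ⟨Q, hr⟩ := exists_isResonant hβ hf_pos hf_int hl hα' hk hkU
  exact ⟨isProbabilityMeasure_flowMeasure hf.continuous hf_pos hf_int,
    measurePreserving_specialFlow α hf.continuous hf_pos, hr.tendsto_time,
    fun g₁ g₂ hg₁ hg₂ => tendsto_correlation_of_isTest hf.continuous hf_pos hf_int
      (fun φ ψ hφ hψ => hr.tendsto_correlation hα' hf hf_pos hf_int hφ hψ) hg₁ hg₂⟩
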